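/- Let $p$ be a probability measure on a measurable space $S$ (the distribution of the test points) and let $K:S\times S\to\mathbb{R}$ be a jointly measurable covariance kernel (symmetric and non-negative definite) with $\int K(x,x)\,dp(x)<\infty$. For $\sigma\in\mathbb{R}$ and a finite training set $X=(x_1,\dots,x_n)\in S^n$, $n\ge 0$, let $$V_\sigma(X)=\int\Big(K(x,x)-K(x,X)\,[K(X,X)+\sigma^2I]^{-1}K(X,x)\Big)\,dp(x)$$ be the expected posterior variance at a test point $x\sim p$ of the Gaussian process with kernel $K$, observed at $X$ without noise ($\sigma=0$) or with independent Gaussian noise of variance $\sigma^2$. Here $^{-1}$ is the Moore–Penrose inverse, that is, the ordinary inverse whenever the matrix is invertible. The integrand is always $p$-integrable. A complete eigensystem of $K$ with respect to $p$ is a family $(\lambda_i,\phi_i)_{i\in I}$ with $\phi_i$ orthonormal in $L^2(p)$ and $\int K(x,y)\phi_i(x)\,dp(x)=\lambda_i\phi_i(y)$ for $p$-almost every $y$, such that no nonzero eigenfunction in $L^2(p)$ with a nonzero eigenvalue is orthogonal to all the $\phi_i$. A complete eigensystem with countable $I$ exists. Let $\xi_1,\xi_2,\dots$ be independent random points with law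 $p$, and put $X_n=(\xi_1,\dots,\xi_n)$. Then for every $\sigma\in\mathbb{R}$: 1. In the large-sample limit, a training set sampled from $p$ is at least as good as every other one: almost surely, for every $\varepsilon>0$ there is an $N$ such that $$V_\sigma(X_n)\le V_\sigma(X')+\varepsilon$$ for all $n\ge N$ and all finite training sets $X'$ of any size. 2. For every complete eigensystem $(\lambda_i,\phi_i)_{i\in I}$ the sum $\sum_i\lambda_i$ converges, the infimum of $V_\sigma(X')$ over all finite training sets $X'$ is $$\int K(x,x)\,dp(x)-\sum_{i}\lambda_i ,$$ and almost surely $V_\sigma(X_n)$ converges to this value as $n\to\infty$. 3. For the RBF kernel $K(x,y)=\exp\big(-\tfrac12\sum_{i=1}^d((x_i-y_i)/\ell_i)^2\big)$ on $\mathbb{R}^d$ with length scales $\ell_i>0$ (which is a covariance kernel), and every probability measure $p$ on $\mathbb{R}^d$, this lowest value is $0$: for every complete eigensystem $\sum_i\lambda_i$ converges and $\int K(x,x)\,dp(x)-\sum_i\lambda_i=0$. -/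

import Mathlib

open MeasureTheory ProbabilityTheory Filter Topology

noncomputable section

/-- The matrix `K(X, X)` of a kernel at the points `X = (x₁, …, x_n)`. -/
def kernelMatrix {S : Type*} (K : S → S → ℝ) {n : ℕ} (X : Fin n → S) :
    Matrix (Fin n) (Fin n) ℝ :=
  Matrix.of fun i j => K (X i) (X j)

/-- A covariance kernel: all the matrices `K(X, X)` are symmetric and non-negative definite. -/
def IsCovarianceKernel {S : Type*} (K : S → S → ℝ) : Prop :=
  ∀ (n : ℕ) (X : Fin n → S), (kernelMatrix K X).PosSemidef

/-- The Moore–Penrose inverse of a symmetric real matrix: `A = ∑ⱼ aⱼ vⱼ vⱼᵀ` (with orthonormal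
`vⱼ`) is sent to `∑_{aⱼ ≠ 0} aⱼ⁻¹ vⱼ vⱼᵀ`. It is `A⁻¹` whenever `A` is invertible
(`symmInv_eq_inv`); it also makes sense of `K(X, X)⁻¹` when `X` has repeated points or when `K` is
degenerate. -/
def symmInv {n : ℕ} (A : Matrix (Fin n) (Fin n) ℝ) : Matrix (Fin n) (Fin n) ℝ :=
  cfc (fun t : ℝ => t⁻¹) A

theorem symmInv_eq_inv {n : ℕ} {A : Matrix (Fin n) (Fin n) ℝ} (hA : A.IsHermitian)
    (h : IsUnit A) : symmInv A = A⁻¹ := by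
  obtain ⟨u, rfl⟩ := h
  have h1 := cfc_inv_id (R := ℝ) u hA.isSelfAdjoint
  rw [symmInv, h1, Matrix.coe_units_inv]

/-- The variance of `f(x)` in the Gaussian process with covariance kernel `K`, given observations
of `f` at `X = (x₁, …, x_n)` with independent Gaussian noise of variance `σ ^ 2`:
`K(x, x) - K(x, X) [K(X, X) + σ² I]⁻¹ K(X, x)`. The noiseless case is `σ = 0`. -/
def posteriorVariance {S : Type*} (K : S → S → ℝ) (σ : ℝ) {n : ℕ} (X : Fin n → S) (x : S) : ℝ :=
  K x x - (fun i => K x (X i)) ⬝ᵥ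
    (symmInv (kernelMatrix K X + σ ^ 2 • (1 : Matrix (Fin n) (Fin n) ℝ))).mulVec
      (fun i => K (X i) x)

/-- The expected posterior variance at a test point with distribution `p`. -/
def expectedVariance {S : Type*} [MeasurableSpace S] (p : Measure S) (K : S → S → ℝ) (σ : ℝ)
    {n : ℕ} (X : Fin n → S) : ℝ :=
  ∫ x, posteriorVariance K σ X x ∂p

/-- `φ` is an eigenfunction, with eigenvalue `c`, of the integral operator of `K` on `L²(p)`
(the zero function is not excluded here). -/
def IsEigenfunction {S : Type*} [MeasurableSpace S] (p : Measure S) (K : S → S → ℝ) (c : ℝ)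
    (φ : S → ℝ) : Prop :=
  MemLp φ 2 p ∧ ∀ᵐ y ∂p, ∫ x, K x y * φ x ∂p = c * φ y

/-- A complete system of eigenvalues `lam i` (repeated according to multiplicity) and orthonormal
eigenfunctions `φ i` of `K` with respect to `p`: complete means that no eigenfunction with a nonzero
eigenvalue is left out. -/
structure IsEigensystem {S : Type*} [MeasurableSpace S] (p : Measure S) (K : S → S → ℝ)
    {ι : Type*} (lam : ι → ℝ) (φ : ι → S → ℝ) : Prop where
  eigen : ∀ i, IsEigenfunction p K (lam i) (φ i)
  norm_one : ∀ i, ∫ x, φ i x * φ i x ∂p = 1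
  orthogonal : ∀ i j, i ≠ j → ∫ x, φ i x * φ j x ∂p = 0
  complete : ∀ (c : ℝ) (f : S → ℝ), c ≠ 0 → IsEigenfunction p K c f →
    (∀ i, ∫ x, f x * φ i x ∂p = 0) → f =ᵐ[p] 0

/-- The RBF (squared exponential) kernel on `ℝᵈ` with length scales `ℓ`:
`exp (- ½ ∑ᵢ ((xᵢ - yᵢ) / ℓᵢ)²)`. -/
def rbfKernel {d : ℕ} (ℓ : Fin d → ℝ) (x y : EuclideanSpace ℝ (Fin d)) : ℝ :=
  Real.exp (-(1 / 2) * ∑ i, ((x i - y i) / ℓ i) ^ 2)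

end

noncomputable section

open scoped InnerProductSpace

-- Kernels as Gram matrices of Hilbert space vectors.

universe u

/-! Write `K x y = ⟪k x, k y⟫` with `k : S → H`, and let `A : H → L²(p)` be `h ↦ ⟪k ·, h⟫` (`toL2`).
Then `A A†` is the integral operator of `K`, and the eigenvalues in a complete eigensystem sum to
the squared Hilbert–Schmidt norm of `A`. The posterior variance at `x` is the minimum over weights
`w` of `‖k x - ∑ w_j k(x_j)‖² + σ² ∑ w_j²` (`predictionError`), also when the matrix is singular.

Lower bound (`sub_le_expectedVariance`): the minimum is at least the squared distance from `k x` to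
the span of the `k(x_j)`. With an orthonormal basis `b` of that span, the integrated gain is at most
`∑ ‖A b_j‖² ≤ ∑ λ_i`, for every training set and every `σ`.

Upper bound (`IsEigensystem.expectedVariance_le`): use weights `w_j(x) = ∑_{i ∈ F} φ_i(x) c_ij` with
`F` finite. By orthonormality the error is `∫ ‖k‖² - ∑_F λ_i` plus `∑_F (‖∑_j c_ij k(x_j) - A†φ_i‖²
+ σ² ∑_j c_ij²)`. For a random sample take `c_ij = g_i(ξ_j)/n`, where `g_i` is a bounded truncation
of `φ_i`. A second moment computation, a weak law of large numbers in `H`, bounds the mean of this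
extra term by the truncation error plus `O(1/n)`; the noise term is itself `O(1/n)`. Since more data
never hurt, smallness in mean becomes almost sure convergence.

The limit does not depend on `σ`. For the RBF kernel it may thus be computed at `σ = 0`, where
observations along a dense sequence drive the variance to `0` because `k` is continuous. -/

/-- A covariance kernel is the Gram matrix of a feature map into a Hilbert space, whose range may be
assumed to span a dense subspace. -/
theorem IsCovarianceKernel.exists_featureMap {S : Type u} {K : S → S → ℝ}
    (hK : IsCovarianceKernel K) :
    ∃ (H : Type u) (_ : NormedAddCommGroup H) (_ : InnerProductSpace ℝ H) (_ : CompleteSpace H)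
      (k : S → H), (∀ x y, ⟪k x, k y⟫_ℝ = K x y) ∧
        (Submodule.span ℝ (Set.range k)).topologicalClosure = ⊤ := by
  let M : Matrix S S (ℝ →L[ℝ] ℝ) := Matrix.of fun x y => K x y • (1 : ℝ →L[ℝ] ℝ)
  have hsymm : ∀ x y, K x y = K y x := by
    intro x y
    have := (hK 2 ![x, y]).isHermitian.apply 0 1
    simpa [kernelMatrix] using this.symm
  have hM : M.PosSemidef := by
    refine ((RKHS.posSemidef_tfae (K := M)).out 0 2).mpr ?_
    refine ⟨?_, ?_⟩
    · ext x y
      simp [M, hsymm x y]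
    · intro v
      classical
      -- Positivity on finitely supported `v` is the matrix condition at the points of its support,
      -- enumerated by `Fin`.
      let e := v.support.equivFin.symm
      have h := (hK v.support.card (fun i => (e i : S))).dotProduct_mulVec_nonneg
        (fun i => v (e i))
      have h2 : v.sum (fun x w => v.sum fun x' w' => ⟪M x' x w, w'⟫_ℝ) =
          star (fun i => v (e i)) ⬝ᵥ
            (kernelMatrix K (fun i => (e i : S))).mulVec (fun i => v (e i)) := by
        simp only [Finsupp.sum, dotProduct, Matrix.mulVec, kernelMatrix, M, Matrix.of_apply]
        rw [← Finset.sum_coe_sort v.support, ← e.sum_comp]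
        refine Finset.sum_congr rfl fun i _ => ?_
        rw [← Finset.sum_coe_sort v.support, ← e.sum_comp, Finset.mul_sum]
        refine Finset.sum_congr rfl fun j _ => ?_
        simp [hsymm (e i : S) (e j : S)]
        ring
      rw [h2]
      simpa using h
  have : Fact M.PosSemidef := ⟨hM⟩
  refine ⟨RKHS.OfKernel M, inferInstance, inferInstance, inferInstance,
    fun x => RKHS.kerFun (RKHS.OfKernel M) x 1, ?_, ?_⟩
  · intro x y
    rw [← RKHS.kernel_inner, RKHS.OfKernel.kernel_ofKernel]
    simp [M, hsymm x y]
  · rw [← RKHS.kerFun_dense (𝕜 := ℝ) (RKHS.OfKernel M)]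
    congr 1
    refine le_antisymm (Submodule.span_mono ?_) (Submodule.span_le.mpr ?_)
    · rintro _ ⟨x, rfl⟩
      exact ⟨x, 1, rfl⟩
    · rintro _ ⟨x, c, rfl⟩
      have : RKHS.kerFun (RKHS.OfKernel M) x c = c • RKHS.kerFun (RKHS.OfKernel M) x 1 := by
        rw [← map_smul]; simp
      rw [this]
      exact Submodule.smul_mem _ _ (Submodule.subset_span ⟨x, rfl⟩)

/-! ### Hilbert–Schmidt operators and the trace of `A A†`. -/

section HilbertSchmidt

variable {E F : Type*} [NormedAddCommGroup E] [InnerProductSpace ℝ E]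
  [NormedAddCommGroup F] [InnerProductSpace ℝ F]

/-- `C` bounds the square of the Hilbert–Schmidt norm of `A`. -/
def HilbertSchmidtBound (A : E →L[ℝ] F) (C : ℝ) : Prop :=
  ∀ (n : ℕ) (e : Fin n → E), Orthonormal ℝ e → ∑ j, ‖A (e j)‖ ^ 2 ≤ C

theorem HilbertSchmidtBound.sum_le {A : E →L[ℝ] F} {C : ℝ} (h : HilbertSchmidtBound A C)
    {ι : Type*} [Fintype ι] {e : ι → E} (he : Orthonormal ℝ e) : ∑ j, ‖A (e j)‖ ^ 2 ≤ C := by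
  rw [← (Fintype.equivFin ι).symm.sum_comp]
  exact h _ _ (he.comp _ (Fintype.equivFin ι).symm.injective)

/-- A compact symmetric operator vanishes on a closed invariant subspace that contains no
eigenvector with a nonzero eigenvalue. -/
theorem eq_zero_on_of_isCompactOperator {T : F →L[ℝ] F} (hT : IsCompactOperator T)
    (hT' : T.IsSymmetric) {W : Submodule ℝ F} [CompleteSpace W] (hinv : ∀ v ∈ W, T v ∈ W)
    (hno : ∀ (c : ℝ), ∀ v ∈ W, c ≠ 0 → T v = c • v → v = 0) : ∀ v ∈ W, T v = 0 := by
  let R : W →L[ℝ] W := T.restrict hinv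
  have hRc : IsCompactOperator R := hT.restrict' (f := (T : F →ₗ[ℝ] F)) hinv
  have hRs : R.IsSymmetric := hT'.restrict_invariant hinv
  have hR : R = 0 := by
    refine (ContinuousLinearMap.eq_zero_of_forall_hasEigenvalue_eq_zero hRc hRs).mp fun c hc => ?_
    by_contra hc0
    obtain ⟨v, hv, hv0⟩ := hc.exists_hasEigenvector
    rw [Module.End.mem_genEigenspace_one] at hv
    exact hv0 (Subtype.ext (hno c v v.2 hc0 (congrArg Subtype.val hv)))
  intro v hv
  have : R ⟨v, hv⟩ = 0 := by rw [hR]; rfl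
  exact congrArg Subtype.val this

variable [CompleteSpace F]

/-- If a finite orthonormal family comes within `(ε/2)²` of the supremum of `∑ ‖A e_j‖²`, a further
unit vector orthogonal to it can add no more than that. So `A` is within `ε/2` of its composition
with a finite rank projection. -/
theorem HilbertSchmidtBound.isCompactOperator {A : E →L[ℝ] F} {C : ℝ}
    (h : HilbertSchmidtBound A C) : IsCompactOperator A := by
  have hcl := isClosed_setOfPred_isCompactOperator (σ₁₂ := RingHom.id ℝ) (M₁ := E) (M₂ := F)
  refine hcl.closure_subset (Metric.mem_closure_iff.mpr fun ε hε => ?_)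
  let s : Set ℝ := {r | ∃ (n : ℕ) (e : Fin n → E), Orthonormal ℝ e ∧ r = ∑ j, ‖A (e j)‖ ^ 2}
  have hs : s.Nonempty := ⟨0, 0, fun i => i.elim0, ⟨fun i => i.elim0, fun i => i.elim0⟩, by simp⟩
  have hbdd : BddAbove s := ⟨C, by rintro _ ⟨n, e, he, rfl⟩; exact h n e he⟩
  obtain ⟨_, ⟨n, e, he, rfl⟩, hlt⟩ := exists_lt_of_lt_csSup hs
    (show sSup s - (ε / 2) ^ 2 < sSup s by nlinarith [sq_pos_of_pos (half_pos hε)])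
  let V : Submodule ℝ E := Submodule.span ℝ (Set.range e)
  have : FiniteDimensional ℝ V := FiniteDimensional.span_of_finite ℝ (Set.finite_range _)
  refine ⟨A ∘L V.starProjection, ?_, ?_⟩
  · have : IsCompactOperator ((A ∘L V.subtypeL) ∘ V.orthogonalProjectionOnto) :=
      (isCompactOperator_id (E := V) |>.clm_comp (A ∘L V.subtypeL)).comp_clm _
    exact this
  have key : ∀ v ∈ Vᗮ, ‖A v‖ ≤ ε / 2 * ‖v‖ := by
    intro v hv
    by_cases hv0 : v = 0
    · simp [hv0]
    have hvn : ‖v‖ ≠ 0 := norm_ne_zero_iff.mpr hv0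
    let e' : Fin (n + 1) → E := Fin.snoc e ((‖v‖⁻¹ : ℝ) • v)
    have he' : ∀ i : Fin n, e' i.castSucc = e i := fun i => by simp [e']
    have hl' : e' (Fin.last n) = (‖v‖⁻¹ : ℝ) • v := by simp [e']
    have hsn : Orthonormal ℝ e' := by
      have hperp : ∀ i, ⟪e i, v⟫_ℝ = 0 := fun i =>
        (Submodule.mem_orthogonal V v).mp hv _ (Submodule.subset_span ⟨i, rfl⟩)
      refine ⟨fun i => ?_, fun i j hij => ?_⟩
      · refine Fin.lastCases ?_ (fun i => ?_) i
        · simp [hl', norm_smul, hvn]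
        · simpa [he'] using he.1 i
      · revert hij
        refine Fin.lastCases ?_ (fun i => ?_) i <;> refine Fin.lastCases ?_ (fun j => ?_) j
        · simp
        · intro _
          rw [hl', he', inner_smul_left, real_inner_comm, hperp, mul_zero]
        · intro _
          rw [hl', he', inner_smul_right, hperp, mul_zero]
        · intro hij
          simpa [he'] using he.2 (fun h => hij (by rw [h]))
    have hle : ∑ j, ‖A (e' j)‖ ^ 2 ≤ sSup s :=
      le_csSup hbdd ⟨n + 1, _, hsn, rfl⟩
    rw [Fin.sum_univ_castSucc] at hle
    simp only [he', hl'] at hle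
    have h1 : ‖A ((‖v‖⁻¹ : ℝ) • v)‖ ^ 2 ≤ (ε / 2) ^ 2 := by linarith
    have h2 := (sq_le_sq₀ (norm_nonneg _) (by positivity)).mp h1
    rw [map_smul, norm_smul, norm_inv, norm_norm, inv_mul_le_iff₀ (by positivity)] at h2
    linarith
  rw [dist_eq_norm]
  refine lt_of_le_of_lt (ContinuousLinearMap.opNorm_le_bound _ (by positivity) fun x => ?_)
    (half_lt_self hε)
  have hx : (A - A ∘L V.starProjection) x = A (x - V.starProjection x) := by simp
  rw [hx]
  refine (key _ (V.sub_starProjection_mem_orthogonal x)).trans ?_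
  gcongr
  rw [← Submodule.starProjection_orthogonal_val]
  exact Submodule.norm_starProjection_apply_le _ _

variable [CompleteSpace E]

/-- Both sides are compared with the double sum of `⟪f_i, A b_j⟫²`: Parseval in the
finite-dimensional span of the `A†f_i`, then Bessel for `f`. -/
theorem HilbertSchmidtBound.adjoint {A : E →L[ℝ] F} {C : ℝ} (h : HilbertSchmidtBound A C) :
    HilbertSchmidtBound A.adjoint C := by
  intro n f hf
  let V : Submodule ℝ E := Submodule.span ℝ (Set.range fun i => A.adjoint (f i))
  have : FiniteDimensional ℝ V := FiniteDimensional.span_of_finite ℝ (Set.finite_range _)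
  let b := stdOrthonormalBasis ℝ V
  have hb : Orthonormal ℝ (fun j => (b j : E)) :=
    b.orthonormal.comp_linearIsometry V.subtypeₗᵢ
  calc ∑ i, ‖A.adjoint (f i)‖ ^ 2 = ∑ i, ∑ j, ‖⟪f i, A (b j)⟫_ℝ‖ ^ 2 := by
        refine Finset.sum_congr rfl fun i _ => ?_
        have hm : A.adjoint (f i) ∈ V := Submodule.subset_span ⟨i, rfl⟩
        have := b.sum_sq_norm_inner_left ⟨_, hm⟩
        rw [show ‖A.adjoint (f i)‖ = ‖(⟨_, hm⟩ : V)‖ from rfl, ← this]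
        refine Finset.sum_congr rfl fun j _ => ?_
        rw [← ContinuousLinearMap.adjoint_inner_left]
        rfl
    _ = ∑ j, ∑ i, ‖⟪f i, A (b j)⟫_ℝ‖ ^ 2 := Finset.sum_comm
    _ ≤ ∑ j, ‖A (b j)‖ ^ 2 := Finset.sum_le_sum fun j _ => hf.sum_inner_products_le _
    _ ≤ C := h.sum_le hb

/-- If an orthonormal system of eigenvectors of `A A†` leaves out no eigenvector with a nonzero
eigenvalue, then its eigenvalues sum up to the square of the Hilbert–Schmidt norm of `A`. -/
theorem HilbertSchmidtBound.summable_and_tsum_eigenvalues {A : E →L[ℝ] F} {C : ℝ}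
    (h : HilbertSchmidtBound A C) {ι : Type*} {lam : ι → ℝ} {φ : ι → F} (hφ : Orthonormal ℝ φ)
    (heig : ∀ i, A (A.adjoint (φ i)) = lam i • φ i)
    (hcomplete : ∀ (c : ℝ) (f : F), c ≠ 0 → A (A.adjoint f) = c • f →
      (∀ i, ⟪φ i, f⟫_ℝ = 0) → f = 0) :
    (∀ i, ‖A.adjoint (φ i)‖ ^ 2 = lam i) ∧ Summable lam ∧
      HilbertSchmidtBound A (∑' i, lam i) := by
  have hlam : ∀ i, ‖A.adjoint (φ i)‖ ^ 2 = lam i := by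
    intro i
    rw [← real_inner_self_eq_norm_sq, ContinuousLinearMap.adjoint_inner_left, heig,
      inner_smul_right, real_inner_self_eq_norm_sq, hφ.1 i]
    simp
  have hsum : Summable lam := by
    refine summable_of_sum_le (c := C) (fun i => by rw [← hlam]; positivity) fun u => ?_
    have := h.adjoint.sum_le (hφ.comp (Subtype.val : u → ι) Subtype.val_injective)
    rw [← Finset.sum_coe_sort]
    simpa [hlam] using this
  refine ⟨hlam, hsum, ?_⟩
  have hcompact : IsCompactOperator (A ∘L A.adjoint) := h.isCompactOperator.comp_clm A.adjoint
  have hsymm : (A ∘L A.adjoint : F →L[ℝ] F).IsSymmetric := fun x y => by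
    simp only [ContinuousLinearMap.coe_coe, ContinuousLinearMap.comp_apply]
    rw [← ContinuousLinearMap.adjoint_inner_right, ContinuousLinearMap.adjoint_inner_left]
  -- On the orthogonal complement of the eigenvectors, `A A†` is compact, symmetric and without
  -- nonzero eigenvalues, hence zero. Then `A†` vanishes there too, as `‖A†v‖² = ⟪v, A A†v⟫`.
  let W : Submodule ℝ F := (Submodule.span ℝ (Set.range φ))ᗮ
  have hW : ∀ v, v ∈ W ↔ ∀ i, ⟪φ i, v⟫_ℝ = 0 := by
    intro v
    rw [Submodule.mem_orthogonal]
    constructor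
    · exact fun h i => h _ (Submodule.subset_span ⟨i, rfl⟩)
    · intro h u hu
      induction hu using Submodule.span_induction with
      | mem x hx => obtain ⟨i, rfl⟩ := hx; exact h i
      | zero => simp
      | add x y _ _ hx hy => rw [inner_add_left, hx, hy, add_zero]
      | smul a x _ hx => rw [inner_smul_left, hx, mul_zero]
  have hinv : ∀ v ∈ W, (A ∘L A.adjoint) v ∈ W := by
    intro v hv
    rw [hW] at hv ⊢
    intro i
    have h1 := hsymm (φ i) v
    change ⟪A (A.adjoint (φ i)), v⟫_ℝ = ⟪φ i, A (A.adjoint v)⟫_ℝ at h1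
    change ⟪φ i, A (A.adjoint v)⟫_ℝ = 0
    rw [← h1, heig, inner_smul_left, hv i, mul_zero]
  have hzero := eq_zero_on_of_isCompactOperator hcompact hsymm hinv fun c v hv hc hcv =>
    hcomplete c v hc hcv ((hW v).mp hv)
  have hker : ∀ v ∈ W, A.adjoint v = 0 := by
    intro v hv
    have h0 : A (A.adjoint v) = 0 := hzero v hv
    rw [← inner_self_eq_zero (𝕜 := ℝ), ContinuousLinearMap.adjoint_inner_left, h0, inner_zero_right]
  -- The basis vectors added to `φ` lie in `W` and contribute nothing to Parseval for `A e`.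
  obtain ⟨w, b, hsub, hb⟩ := hφ.toSubtypeRange.exists_hilbertBasis_extension
  have hpars : ∀ e : E, HasSum (fun i => ⟪A.adjoint (φ i), e⟫_ℝ ^ 2) (‖A e‖ ^ 2) := by
    intro e
    have h1 := b.hasSum_inner_mul_inner (A e) (A e)
    rw [real_inner_self_eq_norm_sq] at h1
    let g : ι → w := fun i => ⟨φ i, hsub ⟨i, rfl⟩⟩
    have hg : Function.Injective g := fun i j hij =>
      hφ.linearIndependent.injective (congrArg Subtype.val hij)
    rw [← hg.hasSum_iff] at h1
    · refine HasSum.congr_fun h1 fun i => ?_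
      have hbg : b (g i) = φ i := by rw [hb]
      change _ = ⟪A e, b (g i)⟫_ℝ * ⟪b (g i), A e⟫_ℝ
      rw [hbg]
      rw [ContinuousLinearMap.adjoint_inner_left, real_inner_comm (φ i), sq]
    · intro v hv
      have hvW : (v : F) ∈ W := by
        rw [hW]
        intro i
        have hne : g i ≠ v := fun h => hv ⟨i, h⟩
        have := b.orthonormal.2 hne
        simpa [hb, g] using this
      have : ⟪b v, A e⟫_ℝ = 0 := by
        rw [hb, ← ContinuousLinearMap.adjoint_inner_left, hker _ hvW, inner_zero_left]
      rw [this, mul_zero]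
  intro n e he
  -- After summing over `j`, Bessel for `e` bounds the `i`-th term by `‖A†φ_i‖² = λ_i`.
  refine hasSum_le (fun i => ?_) (hasSum_sum fun j _ => hpars (e j)) hsum.hasSum
  rw [← hlam i]
  refine le_trans (le_of_eq ?_) (he.sum_inner_products_le (A.adjoint (φ i)) (s := Finset.univ))
  refine Finset.sum_congr rfl fun j _ => ?_
  rw [real_inner_comm, Real.norm_eq_abs, sq_abs]

end HilbertSchmidt

/-! ### The integral operator of a kernel and its eigensystems. -/

section IntegralOperator

variable {S : Type*} {H : Type*} [NormedAddCommGroup H] [InnerProductSpace ℝ H] {k : S → H}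

theorem forall_mem_of_topologicalClosure_span_eq_top
    (hk : (Submodule.span ℝ (Set.range k)).topologicalClosure = ⊤) {V : Submodule ℝ H}
    (hV : IsClosed (V : Set H)) (hmem : ∀ x, k x ∈ V) (h : H) : h ∈ V := by
  have h1 : (Submodule.span ℝ (Set.range k)).topologicalClosure ≤ V :=
    Submodule.topologicalClosure_minimal _
      (Submodule.span_le.mpr (by rintro _ ⟨x, rfl⟩; exact hmem x)) hV
  exact h1 (hk ▸ Submodule.mem_top)

variable [MeasurableSpace S]

/-- For `h = k y` this is a section of the kernel, and the good `h` form a subspace closed under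
sequential limits. No separability of `H` is needed. -/
theorem measurable_inner_featureMap
    (hk : (Submodule.span ℝ (Set.range k)).topologicalClosure = ⊤)
    (hm : Measurable (Function.uncurry fun x y => ⟪k x, k y⟫_ℝ)) (h : H) :
    Measurable fun x => ⟪k x, h⟫_ℝ := by
  let V : Submodule ℝ H :=
    { carrier := {h | Measurable fun x => ⟪k x, h⟫_ℝ}
      zero_mem' := by simp
      add_mem' := fun {a b} ha hb => by
        simp only [Set.mem_ofPred_eq, inner_add_right] at *
        exact ha.add hb
      smul_mem' := fun c a ha => by
        simp only [Set.mem_ofPred_eq, inner_smul_right] at *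
        exact ha.const_mul c }
  refine forall_mem_of_topologicalClosure_span_eq_top hk (V := V) ?_ (fun y => ?_) h
  · refine isClosed_of_closure_subset fun a ha => ?_
    obtain ⟨u, hu, hlim⟩ := mem_closure_iff_seq_limit.mp ha
    exact measurable_of_tendsto_metrizable (f := fun n x => ⟪k x, u n⟫_ℝ) hu
      (tendsto_pi_nhds.mpr fun x => tendsto_const_nhds.inner hlim)
  · exact hm.comp (measurable_id.prodMk measurable_const)

/-- The feature map `k` of a jointly measurable covariance kernel `⟪k x, k y⟫` with an integrable
diagonal. -/
structure IsFeatureMap (p : Measure S) (k : S → H) : Prop where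
  dense : (Submodule.span ℝ (Set.range k)).topologicalClosure = ⊤
  measurable : Measurable (Function.uncurry fun x y => ⟪k x, k y⟫_ℝ)
  integrable : Integrable (fun x => ‖k x‖ ^ 2) p

variable {p : Measure S}

namespace IsFeatureMap

theorem memLp_inner (hk : IsFeatureMap p k) (h : H) : MemLp (fun x => ⟪k x, h⟫_ℝ) 2 p := by
  have hm := measurable_inner_featureMap hk.dense hk.measurable h
  rw [memLp_two_iff_integrable_sq hm.aestronglyMeasurable]
  refine (hk.integrable.mul_const (‖h‖ ^ 2)).mono' (hm.pow_const 2).aestronglyMeasurable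
    (ae_of_all _ fun x => ?_)
  rw [Real.norm_of_nonneg (sq_nonneg _), ← mul_pow, sq_le_sq, abs_of_nonneg
    (by positivity : 0 ≤ ‖k x‖ * ‖h‖)]
  exact abs_real_inner_le_norm _ _

/-- The inclusion of the Hilbert space of a kernel into `L²(p)`. -/
def toL2 (hk : IsFeatureMap p k) : H →L[ℝ] Lp ℝ 2 p :=
  LinearMap.mkContinuous
    { toFun := fun h => (hk.memLp_inner h).toLp
      map_add' := fun a b => by
        rw [← MemLp.toLp_add]
        congr 1
        ext x
        simp [inner_add_right]
      map_smul' := fun c a => by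
        rw [RingHom.id_apply, ← MemLp.toLp_const_smul]
        congr 1
        ext x
        simp [inner_smul_right] }
    (Real.sqrt (∫ x, ‖k x‖ ^ 2 ∂p)) fun h => by
      rw [← Real.sqrt_sq (norm_nonneg h), ← Real.sqrt_mul (integral_nonneg fun x => sq_nonneg _)]
      refine Real.le_sqrt_of_sq_le ?_
      rw [← real_inner_self_eq_norm_sq, L2.inner_def, ← integral_mul_const]
      refine integral_mono_ae (L2.integrable_inner _ _) (hk.integrable.mul_const _) ?_
      filter_upwards [(hk.memLp_inner h).coeFn_toLp] with x hx
      simp only [LinearMap.coe_mk, AddHom.coe_mk]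
      rw [hx, real_inner_self_eq_norm_sq, ← mul_pow, Real.norm_eq_abs, sq_abs, sq_le_sq,
        abs_of_nonneg (by positivity : 0 ≤ ‖k x‖ * ‖h‖)]
      exact abs_real_inner_le_norm _ _

theorem coeFn_toL2 (hk : IsFeatureMap p k) (h : H) :
    hk.toL2 h =ᵐ[p] fun x => ⟪k x, h⟫_ℝ :=
  (hk.memLp_inner h).coeFn_toLp

theorem norm_toL2_sq (hk : IsFeatureMap p k) (h : H) :
    ‖hk.toL2 h‖ ^ 2 = ∫ x, ⟪k x, h⟫_ℝ ^ 2 ∂p := by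
  rw [← real_inner_self_eq_norm_sq, L2.inner_def]
  refine integral_congr_ae ?_
  filter_upwards [hk.coeFn_toL2 h] with x hx
  rw [hx, real_inner_self_eq_norm_sq, Real.norm_eq_abs, sq_abs]

theorem inner_toL2_toLp (hk : IsFeatureMap p k) (h : H) {f : S → ℝ} (hf : MemLp f 2 p) :
    ⟪hk.toL2 h, hf.toLp⟫_ℝ = ∫ x, ⟪k x, h⟫_ℝ * f x ∂p := by
  rw [L2.inner_def]
  refine integral_congr_ae ?_
  filter_upwards [hk.coeFn_toL2 h, hf.coeFn_toLp] with x hx hx'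
  rw [hx, hx', ← real_inner_comm, RCLike.inner_apply, conj_trivial]

theorem sum_norm_toL2_sq (hk : IsFeatureMap p k) {ι : Type*} [Fintype ι] (e : ι → H) :
    ∑ j, ‖hk.toL2 (e j)‖ ^ 2 = ∫ x, ∑ j, ⟪k x, e j⟫_ℝ ^ 2 ∂p := by
  rw [integral_finsetSum _ fun j _ => (hk.memLp_inner (e j)).integrable_sq]
  exact Finset.sum_congr rfl fun j _ => hk.norm_toL2_sq _

/-- Bessel's inequality for `k x`, integrated over `x`. -/
theorem hilbertSchmidtBound (hk : IsFeatureMap p k) :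
    HilbertSchmidtBound hk.toL2 (∫ x, ‖k x‖ ^ 2 ∂p) := by
  intro n e he
  rw [hk.sum_norm_toL2_sq]
  refine integral_mono (integrable_finsetSum _ fun j _ => (hk.memLp_inner (e j)).integrable_sq)
    hk.integrable fun x => ?_
  refine le_trans (le_of_eq ?_) (he.sum_inner_products_le (k x) (s := Finset.univ))
  refine Finset.sum_congr rfl fun j _ => ?_
  rw [real_inner_comm, Real.norm_eq_abs, sq_abs]

variable [CompleteSpace H]

/-- `A†f` plays the role of `∫ f k dp`, as a weak integral known through its inner products only. -/
theorem inner_adjoint_toLp (hk : IsFeatureMap p k) {f : S → ℝ} (hf : MemLp f 2 p) (h : H) :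
    ⟪h, hk.toL2.adjoint hf.toLp⟫_ℝ = ∫ x, ⟪k x, h⟫_ℝ * f x ∂p := by
  rw [ContinuousLinearMap.adjoint_inner_right, hk.inner_toL2_toLp]

/-- Evaluating the weak integral `A†f` against `k y` gives `∫ K(x, y) f(x) dp(x)`. -/
theorem isEigenfunction_iff (hk : IsFeatureMap p k) {c : ℝ} {f : S → ℝ} (hf : MemLp f 2 p) :
    IsEigenfunction p (fun x y => ⟪k x, k y⟫_ℝ) c f ↔
      hk.toL2 (hk.toL2.adjoint hf.toLp) = c • hf.toLp := by
  have h1 : hk.toL2 (hk.toL2.adjoint hf.toLp) =ᵐ[p] fun y => ∫ x, ⟪k x, k y⟫_ℝ * f x ∂p := by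
    filter_upwards [hk.coeFn_toL2 (hk.toL2.adjoint hf.toLp)] with y hy
    rw [hy, hk.inner_adjoint_toLp]
  have h2 : ⇑(c • hf.toLp) =ᵐ[p] fun y => c * f y := by
    filter_upwards [Lp.coeFn_smul c hf.toLp, hf.coeFn_toLp] with y hy hy'
    rw [hy, Pi.smul_apply, hy', smul_eq_mul]
  rw [IsEigenfunction, and_iff_right hf]
  constructor
  · intro h
    exact Lp.ext (h1.trans (EventuallyEq.trans h h2.symm))
  · intro h
    rw [h] at h1
    exact h1.symm.trans h2

end IsFeatureMap

theorem inner_toLp_toLp {f g : S → ℝ} (hf : MemLp f 2 p) (hg : MemLp g 2 p) :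
    ⟪hf.toLp, hg.toLp⟫_ℝ = ∫ x, f x * g x ∂p := by
  rw [L2.inner_def]
  refine integral_congr_ae ?_
  filter_upwards [hf.coeFn_toLp, hg.coeFn_toLp] with x hx hx'
  rw [hx, hx', ← real_inner_comm, RCLike.inner_apply, conj_trivial]

variable {ι : Type*} {lam : ι → ℝ} {φ : ι → S → ℝ} {K : S → S → ℝ}

theorem IsEigensystem.memLp (h : IsEigensystem p K lam φ) (i : ι) : MemLp (φ i) 2 p :=
  (h.eigen i).1

theorem IsEigensystem.orthonormal (h : IsEigensystem p K lam φ) :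
    Orthonormal ℝ fun i => (h.memLp i).toLp := by
  refine ⟨fun i => ?_, fun i j hij => ?_⟩
  · have := inner_toLp_toLp (h.memLp i) (h.memLp i)
    rw [h.norm_one, real_inner_self_eq_norm_sq] at this
    exact (pow_eq_one_iff_of_nonneg (norm_nonneg _) two_ne_zero).mp this
  · exact (inner_toLp_toLp _ _).trans (h.orthogonal i j hij)

variable [CompleteSpace H]

theorem IsEigensystem.toL2_adjoint_toLp (hk : IsFeatureMap p k)
    (h : IsEigensystem p (fun x y => ⟪k x, k y⟫_ℝ) lam φ) (i : ι) :
    hk.toL2 (hk.toL2.adjoint (h.memLp i).toLp) = lam i • (h.memLp i).toLp :=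
  (hk.isEigenfunction_iff _).mp (h.eigen i)

theorem IsEigensystem.summable_and_hilbertSchmidtBound (hk : IsFeatureMap p k)
    (h : IsEigensystem p (fun x y => ⟪k x, k y⟫_ℝ) lam φ) :
    (∀ i, ‖hk.toL2.adjoint (h.memLp i).toLp‖ ^ 2 = lam i) ∧ Summable lam ∧
      HilbertSchmidtBound hk.toL2 (∑' i, lam i) := by
  refine hk.hilbertSchmidtBound.summable_and_tsum_eigenvalues h.orthonormal
    (h.toL2_adjoint_toLp hk) fun c f hc hf hperp => ?_
  have hff : (Lp.memLp f).toLp = f := Lp.toLp_coeFn f (Lp.memLp f)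
  have := h.complete c f hc ((hk.isEigenfunction_iff (Lp.memLp f)).mpr (by rw [hff, hf]))
    fun i => by
      rw [← inner_toLp_toLp (Lp.memLp f) (h.memLp i), hff, real_inner_comm]
      exact hperp i
  exact (Lp.eq_zero_iff_ae_eq_zero).mpr this

/-- A covariance kernel with an integrable diagonal has a countable complete eigensystem: a
maximal orthonormal set of eigenvectors with nonzero eigenvalues. -/
theorem IsFeatureMap.exists_isEigensystem (hk : IsFeatureMap p k) :
    ∃ (κ : Type) (_ : Countable κ) (lam : κ → ℝ) (φ : κ → S → ℝ),
      IsEigensystem p (fun x y => ⟪k x, k y⟫_ℝ) lam φ := by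
  let A := hk.toL2
  let good : Set (Set (Lp ℝ 2 p)) := {s | Orthonormal ℝ (Subtype.val : s → Lp ℝ 2 p) ∧
    ∀ f ∈ s, ∃ c : ℝ, c ≠ 0 ∧ A (A.adjoint f) = c • f}
  obtain ⟨s, hs⟩ : ∃ s, Maximal (· ∈ good) s := by
    refine zorn_subset good fun t ht hchain =>
      ⟨⋃₀ t, ⟨?_, ?_⟩, fun u hu => Set.subset_sUnion_of_mem hu⟩
    · exact orthonormal_sUnion_of_directed hchain.directedOn fun a ha => (ht ha).1
    · rintro f ⟨u, hu, hf⟩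
      exact (ht hu).2 f hf
  have horth := hs.prop.1
  choose! lam hlam0 hlam using hs.prop.2
  have hnorm : ∀ f : s, ‖A.adjoint (f : Lp ℝ 2 p)‖ ^ 2 = lam f := by
    intro f
    rw [← real_inner_self_eq_norm_sq, ContinuousLinearMap.adjoint_inner_left, hlam f f.2,
      inner_smul_right, real_inner_self_eq_norm_sq, horth.1 f]
    simp
  have hsum : Summable fun f : s => lam f := by
    refine summable_of_sum_le (c := ∫ x, ‖k x‖ ^ 2 ∂p)
      (fun f => by rw [← hnorm]; positivity) fun u => ?_
    have := hk.hilbertSchmidtBound.adjoint.sum_le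
      (horth.comp (Subtype.val : u → s) Subtype.val_injective)
    rw [← Finset.sum_coe_sort]
    simp only [Function.comp_apply] at this
    exact le_trans (le_of_eq (Finset.sum_congr rfl fun f _ => (hnorm f).symm)) this
  -- A summable family has countable support, and here no eigenvalue is zero.
  have hcount : Countable s := by
    have h1 := hsum.countable_support
    have h2 : Function.support (fun f : s => lam f) = Set.univ :=
      Set.eq_univ_of_forall fun f => hlam0 f f.2
    rw [h2] at h1
    exact Set.countable_univ_iff.mp h1
  have : Small.{0} s := Countable.toSmall s
  let e : Shrink.{0} s ≃ s := (equivShrink s).symm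
  refine ⟨Shrink.{0} s, e.countable_iff.mpr hcount, fun i => lam (e i),
    fun i => ((e i : Lp ℝ 2 p) : S → ℝ), ?_, ?_, ?_, ?_⟩
  · intro i
    refine (hk.isEigenfunction_iff (Lp.memLp _)).mpr ?_
    rw [Lp.toLp_coeFn]
    exact hlam _ (e i).2
  · intro i
    rw [← inner_toLp_toLp (Lp.memLp _) (Lp.memLp _), Lp.toLp_coeFn, real_inner_self_eq_norm_sq,
      horth.1 (e i)]
    simp
  · intro i j hij
    rw [← inner_toLp_toLp (Lp.memLp _) (Lp.memLp _), Lp.toLp_coeFn, Lp.toLp_coeFn]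
    exact horth.2 (e.injective.ne hij)
  · intro c f hc hf hperp
    by_contra hne
    have hf2 := hf.1
    let F : Lp ℝ 2 p := hf2.toLp
    have hF : F ≠ 0 := fun h => hne (by
      have h1 := hf2.coeFn_toLp
      have h2 := (Lp.eq_zero_iff_ae_eq_zero).mp h
      exact h1.symm.trans h2)
    have hFn : ‖F‖ ≠ 0 := norm_ne_zero_iff.mpr hF
    have hFp : ∀ g : s, ⟪F, g⟫_ℝ = 0 := by
      intro g
      have h1 := hperp (e.symm g)
      rw [← inner_toLp_toLp hf2 (Lp.memLp _), Lp.toLp_coeFn, e.apply_symm_apply] at h1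
      exact h1
    -- The normalised missing eigenvector could be added to `s`, against maximality.
    let G : Lp ℝ 2 p := (‖F‖⁻¹ : ℝ) • F
    have hGp : ∀ g ∈ s, ⟪G, g⟫_ℝ = 0 := fun g hg => by
      rw [inner_smul_left, hFp ⟨g, hg⟩, mul_zero]
    have hG1 : ‖G‖ = 1 := by simp [G, norm_smul, hFn]
    have hGs : G ∉ s := fun h => by
      have := hGp G h
      rw [real_inner_self_eq_norm_sq, hG1] at this
      norm_num at this
    have hins : insert G s ∈ good := by
      refine ⟨?_, ?_⟩
      · refine ⟨?_, ?_⟩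
        · rintro ⟨g, rfl | hg⟩
          · exact hG1
          · exact horth.1 ⟨g, hg⟩
        · rintro ⟨g, rfl | hg⟩ ⟨g', rfl | hg'⟩ hne'
          · exact absurd rfl hne'
          · exact hGp g' hg'
          · rw [real_inner_comm]
            exact hGp g hg
          · exact horth.2 (i := ⟨g, hg⟩) (j := ⟨g', hg'⟩)
              fun h => hne' (Subtype.ext (congrArg (fun q : s => (q : Lp ℝ 2 p)) h :))
      · rintro g (rfl | hg)
        · refine ⟨c, hc, ?_⟩
          have := (hk.isEigenfunction_iff hf2).mp hf
          rw [map_smul, map_smul, smul_comm c]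
          exact congrArg _ this
        · exact hs.prop.2 g hg
    exact hGs (hs.le_of_ge hins (Set.subset_insert _ _) (Set.mem_insert _ _))

end IntegralOperator

/-! ### Algebra of the Moore–Penrose inverse. -/

theorem mul_symmInv_comm {n : ℕ} (A : Matrix (Fin n) (Fin n) ℝ) :
    A * symmInv A = symmInv A * A := by
  have := cfc_commute_cfc (fun t : ℝ => t) (fun t : ℝ => t⁻¹) A
  by_cases hA : IsSelfAdjoint A
  · rw [cfc_id' ℝ A] at this
    exact this
  -- Without self-adjointness the functional calculus returns `0`.
  · rw [symmInv, cfc_apply_of_not_predicate A hA]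
    simp

/-- `t * t⁻¹ * t = t` also at `t = 0`, where `0⁻¹ = 0`; on the finite spectrum every function is
continuous. -/
theorem mul_symmInv_mul_self {n : ℕ} {A : Matrix (Fin n) (Fin n) ℝ} (hA : A.IsHermitian) :
    A * symmInv A * A = A := by
  have hsa : IsSelfAdjoint A := hA
  have hc : ∀ f : ℝ → ℝ, ContinuousOn f (spectrum ℝ A) := fun f =>
    (Matrix.finite_real_spectrum (A := A)).continuousOn f
  calc A * symmInv A * A
      = cfc (fun t : ℝ => t) A * cfc (fun t : ℝ => t⁻¹) A * cfc (fun t : ℝ => t) A := by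
        rw [cfc_id' ℝ A, symmInv]
    _ = cfc (fun t : ℝ => t) A := by
        rw [← cfc_mul _ _ A (hc _) (hc _), ← cfc_mul _ _ A (hc _) (hc _)]
        refine cfc_congr fun t _ => ?_
        rcases eq_or_ne t 0 with rfl | h
        · simp
        · field_simp
    _ = A := cfc_id' ℝ A

/-! ### Posterior variance as the least error of linear prediction. -/

section PosteriorVariance

open Matrix

variable {S : Type*} {H : Type*} [NormedAddCommGroup H] [InnerProductSpace ℝ H] {k : S → H}

/-- The mean squared error of the linear predictor with weights `w`. -/
def predictionError (k : S → H) (σ : ℝ) {n : ℕ} (X : Fin n → S) (x : S) (w : Fin n → ℝ) : ℝ :=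
  ‖k x - ∑ j, w j • k (X j)‖ ^ 2 + σ ^ 2 * ∑ j, w j ^ 2

theorem dotProduct_noisyKernelMatrix_mulVec (k : S → H) (σ : ℝ) {n : ℕ} (X : Fin n → S)
    (w u : Fin n → ℝ) :
    w ⬝ᵥ (kernelMatrix (fun x y => ⟪k x, k y⟫_ℝ) X + σ ^ 2 • (1 : Matrix (Fin n) (Fin n) ℝ)) *ᵥ u =
      ⟪∑ j, w j • k (X j), ∑ j, u j • k (X j)⟫_ℝ + σ ^ 2 * ∑ j, w j * u j := by
  rw [add_mulVec, smul_mulVec, one_mulVec, dotProduct_add, dotProduct_smul, smul_eq_mul]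
  congr 1
  simp only [dotProduct, mulVec, kernelMatrix, of_apply, sum_inner, inner_sum, inner_smul_left,
    inner_smul_right, conj_trivial, Finset.mul_sum]
  conv_lhs => rw [Finset.sum_comm]
  refine Finset.sum_congr rfl fun i _ => Finset.sum_congr rfl fun j _ => ?_
  ring

theorem noisyKernelMatrix_isHermitian (k : S → H) (σ : ℝ) {n : ℕ} (X : Fin n → S) :
    (kernelMatrix (fun x y => ⟪k x, k y⟫_ℝ) X +
      σ ^ 2 • (1 : Matrix (Fin n) (Fin n) ℝ)).IsHermitian := by
  ext i j
  simp [kernelMatrix, real_inner_comm, one_apply, eq_comm]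

theorem predictionError_eq (k : S → H) (σ : ℝ) {n : ℕ} (X : Fin n → S) (x : S) (w : Fin n → ℝ) :
    predictionError k σ X x w = ⟪k x, k x⟫_ℝ - 2 * ∑ j, w j * ⟪k (X j), k x⟫_ℝ +
      w ⬝ᵥ (kernelMatrix (fun x y => ⟪k x, k y⟫_ℝ) X +
        σ ^ 2 • (1 : Matrix (Fin n) (Fin n) ℝ)) *ᵥ w := by
  rw [dotProduct_noisyKernelMatrix_mulVec, predictionError, norm_sub_sq_real,
    real_inner_self_eq_norm_sq, real_inner_self_eq_norm_sq, inner_sum]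
  simp only [inner_smul_right, sq, real_inner_comm (k x)]
  ring

/-- The weights of the best linear predictor solve the normal equations, even when the matrix is
singular. -/
theorem mulVec_symmInv_mulVec (k : S → H) (σ : ℝ) {n : ℕ} (X : Fin n → S) (x : S) :
    (kernelMatrix (fun x y => ⟪k x, k y⟫_ℝ) X + σ ^ 2 • (1 : Matrix (Fin n) (Fin n) ℝ)) *ᵥ
      (symmInv (kernelMatrix (fun x y => ⟪k x, k y⟫_ℝ) X +
        σ ^ 2 • (1 : Matrix (Fin n) (Fin n) ℝ)) *ᵥ fun i => ⟪k (X i), k x⟫_ℝ) =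
      fun i => ⟪k (X i), k x⟫_ℝ := by
  have hq := dotProduct_noisyKernelMatrix_mulVec k σ X
  have hM := noisyKernelMatrix_isHermitian k σ X
  set M := kernelMatrix (fun x y => ⟪k x, k y⟫_ℝ) X + σ ^ 2 • (1 : Matrix (Fin n) (Fin n) ℝ)
  set b : Fin n → ℝ := fun i => ⟪k (X i), k x⟫_ℝ with hb
  -- The residual `v` is in the kernel of `M`, so the quadratic form gives `∑ v_j k(x_j) = 0`. Hence
  -- `v` is orthogonal to `b` and to the range of `M`, therefore to itself.
  set v : Fin n → ℝ := b - M *ᵥ (symmInv M *ᵥ b) with hv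
  have hMv : M *ᵥ v = 0 := by
    rw [hv, mulVec_sub, mulVec_mulVec b M (symmInv M), mul_symmInv_comm, mulVec_mulVec,
      ← mul_assoc, mul_symmInv_mul_self hM, sub_self]
  have hzero : ∑ j, v j • k (X j) = 0 := by
    have h := hq v v
    rw [hMv, dotProduct_zero, real_inner_self_eq_norm_sq] at h
    have h1 : 0 ≤ σ ^ 2 * ∑ j, v j * v j :=
      mul_nonneg (sq_nonneg _) (Finset.sum_nonneg fun j _ => mul_self_nonneg _)
    have h2 : ‖∑ j, v j • k (X j)‖ ^ 2 = 0 := by nlinarith [sq_nonneg ‖∑ j, v j • k (X j)‖]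
    simpa using h2
  have hvb : v ⬝ᵥ b = 0 := by
    have : v ⬝ᵥ b = ⟪∑ j, v j • k (X j), k x⟫_ℝ := by
      simp [dotProduct, hb, sum_inner, inner_smul_left]
    rw [this, hzero, inner_zero_left]
  have hvM : v ⬝ᵥ M *ᵥ (symmInv M *ᵥ b) = 0 := by
    have hMt : Mᵀ = M := by simpa using hM.eq
    rw [dotProduct_mulVec, ← mulVec_transpose, hMt, hMv, zero_dotProduct]
  have hvv : v ⬝ᵥ v = 0 := by
    conv_lhs => rw [hv, ← hv, dotProduct_sub, hvb, hvM, sub_zero]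
  have hv0 : v = 0 := dotProduct_self_eq_zero.mp hvv
  exact (sub_eq_zero.mp hv0).symm

/-- Completing the square around the solution `w₀` of the normal equations; the excess is the
quadratic form of the noisy matrix at `w - w₀`. -/
theorem predictionError_sub_posteriorVariance (k : S → H) (σ : ℝ) {n : ℕ} (X : Fin n → S) (x : S)
    (w : Fin n → ℝ) :
    ∃ w₀ : Fin n → ℝ, predictionError k σ X x w =
      posteriorVariance (fun x y => ⟪k x, k y⟫_ℝ) σ X x +
        (‖∑ j, (w - w₀) j • k (X j)‖ ^ 2 + σ ^ 2 * ∑ j, (w - w₀) j * (w - w₀) j) ∧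
      posteriorVariance (fun x y => ⟪k x, k y⟫_ℝ) σ X x = predictionError k σ X x w₀ := by
  have hmul := mulVec_symmInv_mulVec k σ X x
  have hq := dotProduct_noisyKernelMatrix_mulVec k σ X
  have hM := noisyKernelMatrix_isHermitian k σ X
  have hpe := predictionError_eq k σ X x
  have hpv : posteriorVariance (fun x y => ⟪k x, k y⟫_ℝ) σ X x =
    ⟪k x, k x⟫_ℝ - (fun i => ⟪k (X i), k x⟫_ℝ) ⬝ᵥ
      (symmInv (kernelMatrix (fun x y => ⟪k x, k y⟫_ℝ) X +
        σ ^ 2 • (1 : Matrix (Fin n) (Fin n) ℝ)) *ᵥ fun i => ⟪k (X i), k x⟫_ℝ) := by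
    simp only [posteriorVariance, real_inner_comm]
  set M := kernelMatrix (fun x y => ⟪k x, k y⟫_ℝ) X + σ ^ 2 • (1 : Matrix (Fin n) (Fin n) ℝ)
  set b : Fin n → ℝ := fun i => ⟪k (X i), k x⟫_ℝ with hb
  set w₀ := symmInv M *ᵥ b
  have hsum : ∀ u : Fin n → ℝ, ∑ j, u j * ⟪k (X j), k x⟫_ℝ = u ⬝ᵥ b := fun u => rfl
  have hMt : Mᵀ = M := by simpa using hM.eq
  have hcross : w₀ ⬝ᵥ M *ᵥ w = w ⬝ᵥ b := by
    rw [dotProduct_mulVec, ← mulVec_transpose, hMt, hmul, dotProduct_comm]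
  refine ⟨w₀, ?_, ?_⟩
  · rw [← real_inner_self_eq_norm_sq, ← hq, hpe, hpv, hsum, mulVec_sub, sub_dotProduct,
      dotProduct_sub, dotProduct_sub, hmul, hcross, dotProduct_comm b w₀]
    ring
  · rw [hpe, hpv, hsum, hmul, dotProduct_comm b w₀]
    ring

theorem posteriorVariance_le_predictionError (k : S → H) (σ : ℝ) {n : ℕ} (X : Fin n → S) (x : S)
    (w : Fin n → ℝ) :
    posteriorVariance (fun x y => ⟪k x, k y⟫_ℝ) σ X x ≤ predictionError k σ X x w := by
  obtain ⟨w₀, h, -⟩ := predictionError_sub_posteriorVariance k σ X x w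
  rw [h]
  have h1 : 0 ≤ ∑ j, (w - w₀) j * (w - w₀) j := Finset.sum_nonneg fun j _ => mul_self_nonneg _
  have h2 := mul_nonneg (sq_nonneg σ) h1
  linarith [sq_nonneg ‖∑ j, (w - w₀) j • k (X j)‖]

theorem exists_posteriorVariance_eq_predictionError (k : S → H) (σ : ℝ) {n : ℕ} (X : Fin n → S)
    (x : S) : ∃ w : Fin n → ℝ,
      posteriorVariance (fun x y => ⟪k x, k y⟫_ℝ) σ X x = predictionError k σ X x w := by
  obtain ⟨w₀, -, h⟩ := predictionError_sub_posteriorVariance k σ X x 0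
  exact ⟨w₀, h⟩

theorem predictionError_nonneg (k : S → H) (σ : ℝ) {n : ℕ} (X : Fin n → S) (x : S)
    (w : Fin n → ℝ) : 0 ≤ predictionError k σ X x w :=
  add_nonneg (sq_nonneg _) (mul_nonneg (sq_nonneg _) (Finset.sum_nonneg fun _ _ => sq_nonneg _))

theorem posteriorVariance_nonneg (k : S → H) (σ : ℝ) {n : ℕ} (X : Fin n → S) (x : S) :
    0 ≤ posteriorVariance (fun x y => ⟪k x, k y⟫_ℝ) σ X x := by
  obtain ⟨w, hw⟩ := exists_posteriorVariance_eq_predictionError k σ X x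
  exact hw ▸ predictionError_nonneg k σ X x w

theorem posteriorVariance_le_norm_sq (k : S → H) (σ : ℝ) {n : ℕ} (X : Fin n → S) (x : S) :
    posteriorVariance (fun x y => ⟪k x, k y⟫_ℝ) σ X x ≤ ‖k x‖ ^ 2 := by
  refine (posteriorVariance_le_predictionError k σ X x 0).trans (le_of_eq ?_)
  simp [predictionError]

/-- More observations do not increase the posterior variance. -/
theorem posteriorVariance_antitone (k : S → H) (σ : ℝ) (s : ℕ → S) {m n : ℕ} (hmn : m ≤ n)
    (x : S) :
    posteriorVariance (fun x y => ⟪k x, k y⟫_ℝ) σ (fun i : Fin n => s i) x ≤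
      posteriorVariance (fun x y => ⟪k x, k y⟫_ℝ) σ (fun i : Fin m => s i) x := by
  obtain ⟨w, hw⟩ := exists_posteriorVariance_eq_predictionError k σ (fun i : Fin m => s i) x
  rw [hw]
  obtain ⟨d, rfl⟩ := Nat.exists_eq_add_of_le hmn
  -- The additional observations receive weight `0`.
  refine (posteriorVariance_le_predictionError k σ _ x
    (Fin.append w (fun _ : Fin d => 0))).trans (le_of_eq ?_)
  simp [predictionError, Fin.sum_univ_add]

/-- Observing a point `X j` without noise bounds the variance by that of the increment. -/
theorem posteriorVariance_zero_le_norm_sub_sq (k : S → H) {n : ℕ} (X : Fin n → S) (x : S)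
    (j : Fin n) : posteriorVariance (fun x y => ⟪k x, k y⟫_ℝ) 0 X x ≤ ‖k x - k (X j)‖ ^ 2 := by
  refine (posteriorVariance_le_predictionError k 0 X x (Pi.single j 1)).trans (le_of_eq ?_)
  simp [predictionError, Pi.single_apply]

variable [MeasurableSpace S] {p : Measure S}

theorem IsFeatureMap.integrable_posteriorVariance (hk : IsFeatureMap p k) (σ : ℝ) {n : ℕ}
    (X : Fin n → S) : Integrable (posteriorVariance (fun x y => ⟪k x, k y⟫_ℝ) σ X) p := by
  have hm : ∀ h, Measurable fun x => ⟪k x, h⟫_ℝ :=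
    measurable_inner_featureMap hk.dense hk.measurable
  have hdiag : Measurable fun x => ⟪k x, k x⟫_ℝ :=
    hk.measurable.comp (measurable_id.prodMk measurable_id)
  have hmeas : Measurable (posteriorVariance (fun x y => ⟪k x, k y⟫_ℝ) σ X) := by
    unfold posteriorVariance
    simp only [dotProduct, mulVec]
    refine hdiag.sub (Finset.measurable_sum _ fun i _ => (hm _).mul
      (Finset.measurable_sum _ fun j _ => ?_))
    simp only [real_inner_comm _ (k (X j))]
    exact (hm _).const_mul _
  refine hk.integrable.mono' hmeas.aestronglyMeasurable (ae_of_all _ fun x => ?_)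
  rw [Real.norm_of_nonneg (posteriorVariance_nonneg k σ X x)]
  exact posteriorVariance_le_norm_sq k σ X x

theorem IsFeatureMap.expectedVariance_antitone (hk : IsFeatureMap p k) (σ : ℝ) (s : ℕ → S) :
    Antitone fun n : ℕ => expectedVariance p (fun x y => ⟪k x, k y⟫_ℝ) σ (fun i : Fin n => s i) :=
  fun _ _ hmn => integral_mono (hk.integrable_posteriorVariance σ _)
    (hk.integrable_posteriorVariance σ _) fun x => posteriorVariance_antitone k σ s hmn x

/-- The gain of any finite training set is bounded by the Hilbert–Schmidt norm of the inclusion. -/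
theorem IsFeatureMap.sub_le_expectedVariance (hk : IsFeatureMap p k) {C : ℝ}
    (hC : HilbertSchmidtBound hk.toL2 C) (σ : ℝ) {n : ℕ} (X : Fin n → S) :
    (∫ x, ‖k x‖ ^ 2 ∂p) - C ≤ expectedVariance p (fun x y => ⟪k x, k y⟫_ℝ) σ X := by
  let V : Submodule ℝ H := Submodule.span ℝ (Set.range fun i => k (X i))
  have : FiniteDimensional ℝ V := FiniteDimensional.span_of_finite ℝ (Set.finite_range _)
  let b := stdOrthonormalBasis ℝ V
  have hb : Orthonormal ℝ (fun j => (b j : H)) :=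
    b.orthonormal.comp_linearIsometry V.subtypeₗᵢ
  have hint : Integrable (fun x => ∑ j, ⟪k x, b j⟫_ℝ ^ 2) p :=
    integrable_finsetSum _ fun j _ => (hk.memLp_inner (b j)).integrable_sq
  -- Without its noise term the optimal error is `‖k x - v‖²` for some `v` in `V`, which is at least
  -- the squared distance from `k x` to `V`.
  have hle : ∀ x, ‖k x‖ ^ 2 - ∑ j, ⟪k x, b j⟫_ℝ ^ 2 ≤
      posteriorVariance (fun x y => ⟪k x, k y⟫_ℝ) σ X x := by
    intro x
    obtain ⟨w, hw⟩ := exists_posteriorVariance_eq_predictionError k σ X x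
    have hmem : ∑ j, w j • k (X j) ∈ V :=
      Submodule.sum_mem _ fun j _ => Submodule.smul_mem _ _ (Submodule.subset_span ⟨j, rfl⟩)
    let v : V := ⟨_, hmem⟩
    have h1 : ∑ j, ⟪k x, b j⟫_ℝ * ⟪(b j : H), v⟫_ℝ = ⟪k x, v⟫_ℝ := by
      conv_rhs => rw [← b.sum_repr v]
      simp only [Submodule.coe_sum, inner_sum, Submodule.coe_smul, inner_smul_right,
        b.repr_apply_apply, Submodule.coe_inner]
      exact Finset.sum_congr rfl fun j _ => mul_comm _ _
    have h2 : ∑ j, ⟪(b j : H), v⟫_ℝ ^ 2 = ‖(v : H)‖ ^ 2 := by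
      have := b.sum_sq_norm_inner_right v
      simpa [Submodule.coe_inner] using this
    have h3 : 0 ≤ ∑ j, (⟪k x, b j⟫_ℝ - ⟪(b j : H), v⟫_ℝ) ^ 2 :=
      Finset.sum_nonneg fun _ _ => sq_nonneg _
    have h4 : ∑ j, (⟪k x, b j⟫_ℝ - ⟪(b j : H), v⟫_ℝ) ^ 2 =
        ∑ j, ⟪k x, b j⟫_ℝ ^ 2 - 2 * ⟪k x, v⟫_ℝ + ‖(v : H)‖ ^ 2 := by
      rw [← h1, ← h2, Finset.mul_sum, ← Finset.sum_sub_distrib, ← Finset.sum_add_distrib]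
      exact Finset.sum_congr rfl fun j _ => by ring
    have h5 : ‖k x - v‖ ^ 2 ≤ posteriorVariance (fun x y => ⟪k x, k y⟫_ℝ) σ X x := by
      rw [hw]
      exact le_add_of_nonneg_right
        (mul_nonneg (sq_nonneg _) (Finset.sum_nonneg fun _ _ => sq_nonneg _))
    rw [norm_sub_sq_real] at h5
    linarith
  have hmono := integral_mono (hk.integrable.sub hint) (hk.integrable_posteriorVariance σ X) hle
  have hsum := hC.sum_le hb
  rw [hk.sum_norm_toL2_sq] at hsum
  have hsub := integral_sub hk.integrable hint
  simp only [Pi.sub_apply] at hmono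
  rw [hsub] at hmono
  exact (sub_le_sub_left hsum _).trans hmono

end PosteriorVariance

/-! ### Predictors built from eigenfunctions, and their error on a random sample. -/

section RandomTrainingSet

variable {S : Type*} {H : Type*} [NormedAddCommGroup H] [InnerProductSpace ℝ H] {k : S → H}
  {ι : Type*}

/-- The error is a quadratic polynomial in `a`. For `a_i = φ_i(x)` its quadratic part involves `x`
only through the products `φ_i φ_l`, to which orthonormality applies. -/
theorem predictionError_sum_smul (k : S → H) (σ : ℝ) {n : ℕ} (X : Fin n → S) (x : S)
    (F : Finset ι) (c : ι → Fin n → ℝ) (a : ι → ℝ) :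
    predictionError k σ X x (fun j => ∑ i ∈ F, a i * c i j) =
      ‖k x‖ ^ 2 - 2 * ∑ i ∈ F, ⟪k x, ∑ j, c i j • k (X j)⟫_ℝ * a i +
        ∑ i ∈ F, ∑ l ∈ F, (⟪∑ j, c i j • k (X j), ∑ j, c l j • k (X j)⟫_ℝ +
          σ ^ 2 * ∑ j, c i j * c l j) * (a i * a l) := by
  have h1 : ∑ j, (∑ i ∈ F, a i * c i j) • k (X j) = ∑ i ∈ F, a i • ∑ j, c i j • k (X j) := by
    simp only [Finset.sum_smul, Finset.smul_sum, mul_smul]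
    exact Finset.sum_comm
  have h2 : ∑ j, (∑ i ∈ F, a i * c i j) ^ 2 =
      ∑ i ∈ F, ∑ l ∈ F, (∑ j, c i j * c l j) * (a i * a l) := by
    simp only [sq, Finset.sum_mul_sum]
    rw [Finset.sum_comm]
    refine Finset.sum_congr rfl fun i _ => ?_
    rw [Finset.sum_comm]
    refine Finset.sum_congr rfl fun l _ => ?_
    rw [Finset.sum_mul]
    exact Finset.sum_congr rfl fun j _ => by ring
  have h3 : ‖∑ i ∈ F, a i • ∑ j, c i j • k (X j)‖ ^ 2 =
      ∑ i ∈ F, ∑ l ∈ F, ⟪∑ j, c i j • k (X j), ∑ j, c l j • k (X j)⟫_ℝ * (a i * a l) := by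
    generalize (fun i => ∑ j, c i j • k (X j)) = u
    rw [← real_inner_self_eq_norm_sq, sum_inner]
    refine Finset.sum_congr rfl fun i _ => ?_
    rw [inner_sum]
    refine Finset.sum_congr rfl fun l _ => ?_
    rw [inner_smul_left, inner_smul_right, conj_trivial]
    ring
  have h4 : ∑ i ∈ F, ∑ l ∈ F, (⟪∑ j, c i j • k (X j), ∑ j, c l j • k (X j)⟫_ℝ +
        σ ^ 2 * ∑ j, c i j * c l j) * (a i * a l) =
      ∑ i ∈ F, ∑ l ∈ F, ⟪∑ j, c i j • k (X j), ∑ j, c l j • k (X j)⟫_ℝ * (a i * a l) +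
        σ ^ 2 * ∑ i ∈ F, ∑ l ∈ F, (∑ j, c i j * c l j) * (a i * a l) := by
    rw [Finset.mul_sum, ← Finset.sum_add_distrib]
    refine Finset.sum_congr rfl fun i _ => ?_
    rw [Finset.mul_sum, ← Finset.sum_add_distrib]
    exact Finset.sum_congr rfl fun l _ => by ring
  have h5 : ⟪k x, ∑ i ∈ F, a i • ∑ j, c i j • k (X j)⟫_ℝ =
      ∑ i ∈ F, ⟪k x, ∑ j, c i j • k (X j)⟫_ℝ * a i := by
    rw [inner_sum]
    exact Finset.sum_congr rfl fun i _ => by rw [inner_smul_right, mul_comm]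
  rw [predictionError, h1, h2, norm_sub_sq_real, h3, h4, h5]
  ring

variable [MeasurableSpace S] {p : Measure S} {lam : ι → ℝ} {φ : ι → S → ℝ} [CompleteSpace H]

/-- Linear predictors whose weights are combinations of eigenfunctions. -/
theorem IsEigensystem.expectedVariance_le (hk : IsFeatureMap p k)
    (h : IsEigensystem p (fun x y => ⟪k x, k y⟫_ℝ) lam φ) (σ : ℝ) {n : ℕ} (X : Fin n → S)
    (F : Finset ι) (c : ι → Fin n → ℝ) :
    expectedVariance p (fun x y => ⟪k x, k y⟫_ℝ) σ X ≤ (∫ x, ‖k x‖ ^ 2 ∂p) - ∑ i ∈ F, lam i +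
      ∑ i ∈ F, (‖∑ j, c i j • k (X j) - hk.toL2.adjoint (h.memLp i).toLp‖ ^ 2 +
        σ ^ 2 * ∑ j, c i j ^ 2) := by
  classical
  let u : ι → H := fun i => ∑ j, c i j • k (X j)
  let B : ι → ι → ℝ := fun i l => ⟪u i, u l⟫_ℝ + σ ^ 2 * ∑ j, c i j * c l j
  have hlam := (h.summable_and_hilbertSchmidtBound hk).1
  have hi1 : ∀ i ∈ F, Integrable (fun x => ⟪k x, u i⟫_ℝ * φ i x) p := fun i _ =>
    (hk.memLp_inner (u i)).integrable_mul (h.memLp i)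
  have hi2 : ∀ i l, Integrable (fun x => B i l * (φ i x * φ l x)) p := fun i l =>
    ((h.memLp i).integrable_mul (h.memLp l)).const_mul _
  have hi3 : ∀ i ∈ F, Integrable (fun x => ∑ l ∈ F, B i l * (φ i x * φ l x)) p := fun i _ =>
    integrable_finsetSum _ fun l _ => hi2 i l
  have hint : Integrable (fun x => ‖k x‖ ^ 2 - 2 * ∑ i ∈ F, ⟪k x, u i⟫_ℝ * φ i x) p :=
    hk.integrable.sub ((integrable_finsetSum _ hi1).const_mul 2)
  have hle : expectedVariance p (fun x y => ⟪k x, k y⟫_ℝ) σ X ≤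
      ∫ x, (‖k x‖ ^ 2 - 2 * ∑ i ∈ F, ⟪k x, u i⟫_ℝ * φ i x +
        ∑ i ∈ F, ∑ l ∈ F, B i l * (φ i x * φ l x)) ∂p := by
    refine integral_mono (hk.integrable_posteriorVariance σ X)
      (hint.add (integrable_finsetSum _ hi3)) fun x => ?_
    refine (posteriorVariance_le_predictionError k σ X x
      (fun j => ∑ i ∈ F, φ i x * c i j)).trans (le_of_eq ?_)
    exact predictionError_sum_smul k σ X x F c fun i => φ i x
  refine hle.trans (le_of_eq ?_)
  rw [integral_add hint (integrable_finsetSum _ hi3),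
    integral_sub hk.integrable ((integrable_finsetSum _ hi1).const_mul 2), integral_const_mul,
    integral_finsetSum _ hi1, integral_finsetSum _ hi3, sub_add, sub_add]
  congr 1
  rw [Finset.mul_sum, ← Finset.sum_sub_distrib, ← Finset.sum_sub_distrib]
  refine Finset.sum_congr rfl fun i hi => ?_
  -- Only `l = i` survives, and `‖u_i‖² - 2⟪u_i, A†φ_i⟫ = ‖u_i - A†φ_i‖² - λ_i`.
  rw [integral_finsetSum _ fun l _ => hi2 i l, Finset.sum_eq_single i]
  · rw [integral_const_mul, h.norm_one, mul_one, ← hk.inner_adjoint_toLp (h.memLp i),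
      norm_sub_sq_real, hlam]
    simp only [B, u, real_inner_self_eq_norm_sq, sq]
    ring
  · intro l _ hl
    rw [integral_const_mul, h.orthogonal i l hl.symm, mul_zero]
  · exact fun h => absurd hi h

/-- Square integrable functions are approximated by bounded ones that vanish where the diagonal of
the kernel is large. -/
theorem IsFeatureMap.exists_bounded_approximation [IsFiniteMeasure p] (hk : IsFeatureMap p k)
    {f : S → ℝ} (hf : MemLp f 2 p) {ε : ℝ} (hε : 0 < ε) :
    ∃ (g : S → ℝ) (M : ℝ), Measurable g ∧ (∀ x, |g x| ≤ M) ∧ (∀ x, g x ≠ 0 → ‖k x‖ ^ 2 ≤ M) ∧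
      ∃ hg : MemLp g 2 p, ‖hk.toL2.adjoint hg.toLp - hk.toL2.adjoint hf.toLp‖ ^ 2 ≤ ε := by
  let f' := hf.1.mk f
  have hf'm : Measurable f' := hf.1.stronglyMeasurable_mk.measurable
  have hff' : f =ᵐ[p] f' := hf.1.ae_eq_mk
  have hdiag : Measurable fun x => ‖k x‖ ^ 2 := by
    simp_rw [← real_inner_self_eq_norm_sq]
    exact hk.measurable.comp (measurable_id.prodMk measurable_id)
  let s : ℕ → Set S := fun m => {x | |f' x| ≤ m ∧ ‖k x‖ ^ 2 ≤ m}
  have hs : ∀ m, MeasurableSet (s m) := fun m =>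
    (measurableSet_le hf'm.abs measurable_const).inter (measurableSet_le hdiag measurable_const)
  let g : ℕ → S → ℝ := fun m => (s m).indicator f'
  have hgm : ∀ m, Measurable (g m) := fun m => hf'm.indicator (hs m)
  have hgle : ∀ m x, |g m x| ≤ |f' x| := fun m x => by
    by_cases hx : x ∈ s m <;> simp [g, hx]
  have hgb : ∀ m x, |g m x| ≤ m := fun m x => by
    by_cases hx : x ∈ s m
    · simpa [g, hx] using hx.1
    · simp [g, hx]
  have hg2 : ∀ m, MemLp (g m) 2 p := fun m =>
    MemLp.of_bound (hgm m).aestronglyMeasurable m (ae_of_all _ fun x => hgb m x)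
  have hlim : Tendsto (fun m => ∫ x, (g m x - f x) ^ 2 ∂p) atTop (𝓝 (∫ _, (0 : ℝ) ∂p)) := by
    refine tendsto_integral_of_dominated_convergence (fun x => f x ^ 2)
      (fun m => (((hg2 m).sub hf).integrable_sq).aestronglyMeasurable) hf.integrable_sq
      (fun m => ?_) ?_
    · filter_upwards [hff'] with x hx
      rw [Real.norm_of_nonneg (sq_nonneg _), hx]
      by_cases hxs : x ∈ s m
      · simp [g, hxs, sq_nonneg]
      · simp [g, hxs]
    · filter_upwards [hff'] with x hx
      refine tendsto_const_nhds.congr' ?_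
      obtain ⟨m₀, hm₀⟩ := exists_nat_ge (max |f' x| (‖k x‖ ^ 2))
      filter_upwards [eventually_ge_atTop m₀] with m hm
      have hmm : (m₀ : ℝ) ≤ m := by exact_mod_cast hm
      have hxs : x ∈ s m :=
        ⟨(le_max_left _ _).trans (hm₀.trans hmm), (le_max_right _ _).trans (hm₀.trans hmm)⟩
      simp [g, hxs, hx]
  rw [integral_zero] at hlim
  set a : ℝ := ‖hk.toL2.adjoint‖ ^ 2 with ha
  have ha0 : 0 ≤ a := sq_nonneg _
  -- The denominator `a + 1` stays positive even if `A† = 0`.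
  obtain ⟨m, hm⟩ := (hlim.eventually (gt_mem_nhds (show 0 < ε / (a + 1) by positivity))).exists
  refine ⟨g m, m, hgm m, hgb m, fun x hx => ?_, hg2 m, ?_⟩
  · by_contra hlt
    exact hx (Set.indicator_of_notMem (fun hxs => hlt hxs.2) _)
  · rw [← map_sub, ← MemLp.toLp_sub]
    have h1 := hk.toL2.adjoint.le_opNorm ((hg2 m).sub hf).toLp
    have h2 : ‖((hg2 m).sub hf).toLp‖ ^ 2 = ∫ x, (g m x - f x) ^ 2 ∂p := by
      rw [← real_inner_self_eq_norm_sq, inner_toLp_toLp]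
      simp only [Pi.sub_apply, sq]
    have h3 : ‖hk.toL2.adjoint ((hg2 m).sub hf).toLp‖ ^ 2 ≤
        a * ‖((hg2 m).sub hf).toLp‖ ^ 2 := by
      rw [ha, ← mul_pow]
      exact pow_le_pow_left₀ (norm_nonneg _) h1 2
    rw [h2] at h3
    rw [lt_div_iff₀ (by positivity)] at hm
    have h4 : 0 ≤ ∫ x, (g m x - f x) ^ 2 ∂p := integral_nonneg fun _ => sq_nonneg _
    linarith

variable {Ω : Type*} [MeasurableSpace Ω] {P : Measure Ω} [IsProbabilityMeasure P]
  [IsProbabilityMeasure p] {ξ : ℕ → Ω → S}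

/-- For `i ≠ j`, independence and Fubini give exactly `‖A†g‖²`. On the diagonal a crude bound
suffices: wherever `g` does not vanish the kernel is at most `M`, so the integrand is at most `M³`.
-/
theorem IsFeatureMap.integral_kernel_comp_le (hk : IsFeatureMap p k)
    (hlaw : ∀ i, HasLaw (ξ i) p P) (hindep : iIndepFun ξ P) {g : S → ℝ} {M : ℝ}
    (hgm : Measurable g) (hgM : ∀ x, |g x| ≤ M) (hgk : ∀ x, g x ≠ 0 → ‖k x‖ ^ 2 ≤ M)
    (hg : MemLp g 2 p) (i j : ℕ) :
    Integrable (fun ω => g (ξ i ω) * g (ξ j ω) * ⟪k (ξ i ω), k (ξ j ω)⟫_ℝ) P ∧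
      ∫ ω, g (ξ i ω) * g (ξ j ω) * ⟪k (ξ i ω), k (ξ j ω)⟫_ℝ ∂P ≤
        ‖hk.toL2.adjoint hg.toLp‖ ^ 2 + if i = j then M ^ 3 else 0 := by
  let q : S × S → ℝ := fun z => g z.1 * g z.2 * ⟪k z.1, k z.2⟫_ℝ
  have hqm : Measurable q := ((hgm.comp measurable_fst).mul (hgm.comp measurable_snd)).mul
    hk.measurable
  have hM : ∀ x : S, 0 ≤ M := fun x => (abs_nonneg _).trans (hgM x)
  have hq : ∀ z, ‖q z‖ ≤ M ^ 3 := by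
    rintro ⟨x, y⟩
    have hM0 := hM x
    by_cases hx : g x = 0
    · simp [q, hx, pow_nonneg hM0]
    by_cases hy : g y = 0
    · simp [q, hy, pow_nonneg hM0]
    have h1 : |⟪k x, k y⟫_ℝ| ≤ M := by
      refine (abs_real_inner_le_norm _ _).trans ?_
      nlinarith [hgk x hx, hgk y hy, sq_nonneg (‖k x‖ - ‖k y‖)]
    calc ‖q (x, y)‖ = |g x| * |g y| * |⟪k x, k y⟫_ℝ| := by
          simp only [q, Real.norm_eq_abs, abs_mul]
      _ ≤ M * M * M := by gcongr <;> exact hgM _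
      _ = M ^ 3 := by ring
  have hpair : AEMeasurable (fun ω => (ξ i ω, ξ j ω)) P :=
    (hlaw i).aemeasurable.prodMk (hlaw j).aemeasurable
  have hint : Integrable (fun ω => q (ξ i ω, ξ j ω)) P :=
    Integrable.of_bound (hqm.comp_aemeasurable hpair).aestronglyMeasurable (M ^ 3)
      (ae_of_all _ fun ω => hq _)
  refine ⟨hint, ?_⟩
  split_ifs with hij
  · have h1 : ∫ ω, q (ξ i ω, ξ j ω) ∂P ≤ ∫ _, M ^ 3 ∂P :=
      integral_mono hint (integrable_const _) fun ω => (le_abs_self _).trans (hq _)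
    rw [integral_const, probReal_univ, one_smul] at h1
    exact h1.trans (le_add_of_nonneg_left (sq_nonneg _))
  · have hl := (indepFun_iff_hasLaw_prodMk_prod (hlaw i) (hlaw j)).mp (hindep.indepFun hij)
    have h1 := hl.integral_comp hqm.aestronglyMeasurable
    rw [add_zero]
    refine le_of_eq (h1.trans ?_)
    rw [integral_prod _ (Integrable.of_bound hqm.aestronglyMeasurable (M ^ 3) (ae_of_all _ hq)),
      ← real_inner_self_eq_norm_sq, hk.inner_adjoint_toLp hg]
    refine integral_congr_ae (ae_of_all _ fun x => ?_)
    simp only [q]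
    rw [hk.inner_adjoint_toLp hg, ← integral_mul_const]
    refine integral_congr_ae (ae_of_all _ fun y => ?_)
    simp only [real_inner_comm (k x)]
    ring

/-- The empirical mean of `g(ξ) k(ξ)` is close to any vector that is close to its expectation. -/
theorem IsFeatureMap.integral_norm_empirical_sub_sq_le (hk : IsFeatureMap p k)
    (hlaw : ∀ i, HasLaw (ξ i) p P) (hindep : iIndepFun ξ P) {g : S → ℝ} {M : ℝ}
    (hgm : Measurable g) (hgM : ∀ x, |g x| ≤ M) (hgk : ∀ x, g x ≠ 0 → ‖k x‖ ^ 2 ≤ M)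
    (hg : MemLp g 2 p) (a : H) (σ : ℝ) {n : ℕ} (hn : 0 < n) :
    Integrable (fun ω => ‖∑ j : Fin n, (g (ξ j ω) / n) • k (ξ j ω) - a‖ ^ 2 +
        σ ^ 2 * ∑ j : Fin n, (g (ξ j ω) / n) ^ 2) P ∧
      ∫ ω, (‖∑ j : Fin n, (g (ξ j ω) / n) • k (ξ j ω) - a‖ ^ 2 +
        σ ^ 2 * ∑ j : Fin n, (g (ξ j ω) / n) ^ 2) ∂P ≤
          ‖hk.toL2.adjoint hg.toLp - a‖ ^ 2 + (M ^ 3 + σ ^ 2 * M ^ 2) / n := by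
  have hn0 : (0 : ℝ) < n := by exact_mod_cast hn
  have hker := fun i j => hk.integral_kernel_comp_le hlaw hindep hgm hgM hgk hg i j
  have hlin : ∀ j, Integrable (fun ω => ⟪k (ξ j ω), a⟫_ℝ * g (ξ j ω)) P ∧
      ∫ ω, ⟪k (ξ j ω), a⟫_ℝ * g (ξ j ω) ∂P = ⟪a, hk.toL2.adjoint hg.toLp⟫_ℝ := by
    intro j
    have hi : Integrable (fun x => ⟪k x, a⟫_ℝ * g x) p := (hk.memLp_inner a).integrable_mul hg
    refine ⟨?_, ?_⟩
    · rw [← (hlaw j).map_eq] at hi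
      exact hi.comp_aemeasurable (hlaw j).aemeasurable
    · rw [hk.inner_adjoint_toLp hg]
      exact (hlaw j).integral_comp hi.aestronglyMeasurable
  have hsq : ∀ j, Integrable (fun ω => g (ξ j ω) ^ 2) P ∧ ∫ ω, g (ξ j ω) ^ 2 ∂P ≤ M ^ 2 := by
    intro j
    have hb : ∀ ω, g (ξ j ω) ^ 2 ≤ M ^ 2 := fun ω => by
      rw [← sq_abs]
      exact pow_le_pow_left₀ (abs_nonneg _) (hgM _) 2
    have hi : Integrable (fun ω => g (ξ j ω) ^ 2) P :=
      Integrable.of_bound ((hgm.pow_const 2).comp_aemeasurable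
        (hlaw j).aemeasurable).aestronglyMeasurable (M ^ 2) (ae_of_all _ fun ω => by
          rw [Real.norm_of_nonneg (sq_nonneg _)]; exact hb ω)
    refine ⟨hi, ?_⟩
    have := integral_mono hi (integrable_const (M ^ 2)) hb
    rwa [integral_const, probReal_univ, one_smul] at this
  -- The square is expanded into scalar kernel values, since `k` is not known to be measurable as a
  -- map into `H`.
  have hrw : ∀ ω, ‖∑ j : Fin n, (g (ξ j ω) / n) • k (ξ j ω) - a‖ ^ 2 +
        σ ^ 2 * ∑ j : Fin n, (g (ξ j ω) / n) ^ 2 =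
      (n : ℝ)⁻¹ ^ 2 * (∑ i : Fin n, ∑ j : Fin n,
          g (ξ i ω) * g (ξ j ω) * ⟪k (ξ i ω), k (ξ j ω)⟫_ℝ) -
        2 * (n : ℝ)⁻¹ * (∑ j : Fin n, ⟪k (ξ j ω), a⟫_ℝ * g (ξ j ω)) + ‖a‖ ^ 2 +
        σ ^ 2 * (n : ℝ)⁻¹ ^ 2 * ∑ j : Fin n, g (ξ j ω) ^ 2 := by
    intro ω
    have h1 : ∑ j : Fin n, (g (ξ j ω) / n) • k (ξ j ω) =
        (n : ℝ)⁻¹ • ∑ j : Fin n, g (ξ j ω) • k (ξ j ω) := by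
      rw [Finset.smul_sum]
      exact Finset.sum_congr rfl fun j _ => by rw [smul_smul, div_eq_inv_mul]
    have h2 : ‖∑ j : Fin n, g (ξ j ω) • k (ξ j ω)‖ ^ 2 = ∑ i : Fin n, ∑ j : Fin n,
        g (ξ i ω) * g (ξ j ω) * ⟪k (ξ i ω), k (ξ j ω)⟫_ℝ := by
      rw [← real_inner_self_eq_norm_sq, sum_inner]
      refine Finset.sum_congr rfl fun i _ => ?_
      rw [inner_sum]
      refine Finset.sum_congr rfl fun j _ => ?_
      rw [inner_smul_left, inner_smul_right, conj_trivial]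
      ring
    rw [norm_sub_sq_real, h1, norm_smul, mul_pow, Real.norm_eq_abs, sq_abs, h2, inner_smul_left,
      conj_trivial, sum_inner]
    simp only [inner_smul_left, conj_trivial, div_eq_inv_mul, mul_pow, ← Finset.mul_sum,
      mul_comm (g _) (inner ℝ _ _)]
    ring
  simp_rw [hrw]
  have i1 : Integrable (fun ω => (n : ℝ)⁻¹ ^ 2 * (∑ i : Fin n, ∑ j : Fin n,
      g (ξ i ω) * g (ξ j ω) * ⟪k (ξ i ω), k (ξ j ω)⟫_ℝ)) P :=
    (integrable_finsetSum Finset.univ fun (i : Fin n) _ =>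
      integrable_finsetSum Finset.univ fun (j : Fin n) _ => (hker i j).1).const_mul _
  have i2 : Integrable (fun ω => 2 * (n : ℝ)⁻¹ * (∑ j : Fin n, ⟪k (ξ j ω), a⟫_ℝ * g (ξ j ω))) P :=
    (integrable_finsetSum Finset.univ fun (j : Fin n) _ => (hlin j).1).const_mul _
  have i3 : Integrable (fun ω => σ ^ 2 * (n : ℝ)⁻¹ ^ 2 * ∑ j : Fin n, g (ξ j ω) ^ 2) P :=
    (integrable_finsetSum Finset.univ fun (j : Fin n) _ => (hsq j).1).const_mul _
  have i4 : Integrable (fun _ : Ω => ‖a‖ ^ 2) P := integrable_const _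
  have i12 := i1.sub i2
  have i124 := i12.add i4
  simp only [Pi.sub_def, Pi.add_def] at i12 i124
  refine ⟨i124.add i3, ?_⟩
  rw [integral_add i124 i3, integral_add i12 i4, integral_sub i1 i2,
    integral_const_mul, integral_const_mul, integral_const_mul, integral_const, probReal_univ,
    one_smul, integral_finsetSum Finset.univ fun (j : Fin n) _ => (hlin j).1,
    integral_finsetSum Finset.univ fun (j : Fin n) _ => (hsq j).1,
    integral_finsetSum Finset.univ fun (i : Fin n) _ =>
      integrable_finsetSum Finset.univ fun (j : Fin n) _ => (hker i j).1]
  -- Only the `n` diagonal pairs cost `M³`; division by `n²` leaves `M³ / n`.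
  have b1 : ∑ i : Fin n, ∫ ω, ∑ j : Fin n, g (ξ i ω) * g (ξ j ω) * ⟪k (ξ i ω), k (ξ j ω)⟫_ℝ ∂P ≤
      n ^ 2 * ‖hk.toL2.adjoint hg.toLp‖ ^ 2 + n * M ^ 3 := by
    calc _ ≤ ∑ i : Fin n, ∑ j : Fin n,
          (‖hk.toL2.adjoint hg.toLp‖ ^ 2 + if i = j then M ^ 3 else 0) := by
          refine Finset.sum_le_sum fun i _ => ?_
          rw [integral_finsetSum Finset.univ fun (j : Fin n) _ => (hker i j).1]
          refine Finset.sum_le_sum fun j _ => ?_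
          simpa [Fin.ext_iff] using (hker i j).2
      _ = _ := by
          simp only [Finset.sum_add_distrib, Finset.sum_ite_eq, Finset.mem_univ, if_true,
            Finset.sum_const, Finset.card_univ, Fintype.card_fin, nsmul_eq_mul]
          ring
  have b2 : ∑ j : Fin n, ∫ ω, ⟪k (ξ j ω), a⟫_ℝ * g (ξ j ω) ∂P =
      n * ⟪a, hk.toL2.adjoint hg.toLp⟫_ℝ := by
    simp [(hlin _).2]
  have b3 : ∑ j : Fin n, ∫ ω, g (ξ j ω) ^ 2 ∂P ≤ n * M ^ 2 := by
    refine (Finset.sum_le_sum fun (j : Fin n) _ => (hsq j).2).trans (le_of_eq ?_)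
    simp
  have c1 := mul_le_mul_of_nonneg_left b1 (sq_nonneg (n : ℝ)⁻¹)
  have c3 := mul_le_mul_of_nonneg_left b3
    (mul_nonneg (sq_nonneg σ) (sq_nonneg (n : ℝ)⁻¹))
  rw [b2, norm_sub_sq_real, real_inner_comm]
  have e1 : (n : ℝ)⁻¹ ^ 2 * (n ^ 2 * ‖hk.toL2.adjoint hg.toLp‖ ^ 2 + n * M ^ 3) =
      ‖hk.toL2.adjoint hg.toLp‖ ^ 2 + M ^ 3 / n := by field_simp
  have e2 : 2 * (n : ℝ)⁻¹ * (n * ⟪hk.toL2.adjoint hg.toLp, a⟫_ℝ) =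
      2 * ⟪hk.toL2.adjoint hg.toLp, a⟫_ℝ := by field_simp
  have e3 : σ ^ 2 * (n : ℝ)⁻¹ ^ 2 * (n * M ^ 2) = σ ^ 2 * M ^ 2 / n := by field_simp
  rw [e1] at c1
  rw [e3] at c3
  rw [e2, add_div]
  linarith

end RandomTrainingSet

/-! ### Almost sure convergence and the infimum. -/

section Convergence

variable {S : Type*} {H : Type*} [NormedAddCommGroup H] [InnerProductSpace ℝ H] {k : S → H}
  [MeasurableSpace S] {p : Measure S} {ι : Type*} {lam : ι → ℝ} {φ : ι → S → ℝ}
  [CompleteSpace H] [IsProbabilityMeasure p]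

section Random

variable {Ω : Type*} [MeasurableSpace Ω] {P : Measure Ω} [IsProbabilityMeasure P] {ξ : ℕ → Ω → S}

/-- Three errors of size `ε/3`: the eigenvalues outside `F`, the truncation of the eigenfunctions in
`F`, and the sampling. The integrable majorant `D` avoids measurability of the expected variance in
`ω`. -/
theorem IsEigensystem.exists_expectedVariance_le_add (hk : IsFeatureMap p k)
    (h : IsEigensystem p (fun x y => ⟪k x, k y⟫_ℝ) lam φ) (hlaw : ∀ i, HasLaw (ξ i) p P)
    (hindep : iIndepFun ξ P) (σ : ℝ) {ε : ℝ} (hε : 0 < ε) :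
    ∃ (n : ℕ) (D : Ω → ℝ), Integrable D P ∧ ∫ ω, D ω ∂P ≤ ε ∧ ∀ ω,
      expectedVariance p (fun x y => ⟪k x, k y⟫_ℝ) σ (fun i : Fin n => ξ i ω) ≤
        (∫ x, ‖k x‖ ^ 2 ∂p) - ∑' i, lam i + D ω := by
  have hsum := (h.summable_and_hilbertSchmidtBound hk).2.1
  obtain ⟨F, hF⟩ := (hsum.hasSum.eventually
    (lt_mem_nhds (show ∑' i, lam i - ε / 3 < ∑' i, lam i by linarith))).exists
  have hη : 0 < ε / (3 * (F.card + 1)) := by positivity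
  choose g M hgm hgM hgk hg hgε using fun i => hk.exists_bounded_approximation (h.memLp i) hη
  let C := ∑ i ∈ F, (M i ^ 3 + σ ^ 2 * M i ^ 2)
  obtain ⟨n₀, hn₀⟩ := exists_nat_gt (3 * C / ε)
  let n := n₀ + 1
  have hn : 0 < n := Nat.succ_pos _
  have hCn : C / n ≤ ε / 3 := by
    have : (n₀ : ℝ) ≤ n := by simp [n]
    rw [div_lt_iff₀ hε] at hn₀
    rw [div_le_iff₀ (by exact_mod_cast hn)]
    nlinarith
  let c : Ω → ι → Fin n → ℝ := fun ω i j => g i (ξ j ω) / n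
  let R : ι → Ω → ℝ := fun i ω =>
    ‖∑ j, c ω i j • k (ξ j ω) - hk.toL2.adjoint (h.memLp i).toLp‖ ^ 2 + σ ^ 2 * ∑ j, c ω i j ^ 2
  have hR : ∀ i, Integrable (R i) P ∧ ∫ ω, R i ω ∂P ≤
      ε / (3 * (F.card + 1)) + (M i ^ 3 + σ ^ 2 * M i ^ 2) / n := by
    intro i
    have := hk.integral_norm_empirical_sub_sq_le hlaw hindep (hgm i) (hgM i) (hgk i) (hg i)
      (hk.toL2.adjoint (h.memLp i).toLp) σ hn
    exact ⟨this.1, this.2.trans (add_le_add_left (hgε i) _)⟩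
  have hRF : Integrable (fun ω => ∑ i ∈ F, R i ω) P := integrable_finsetSum _ fun i _ => (hR i).1
  refine ⟨n, fun ω => (∑' i, lam i - ∑ i ∈ F, lam i) + ∑ i ∈ F, R i ω,
    (integrable_const _).add hRF, ?_, fun ω => ?_⟩
  · rw [integral_add (integrable_const _) hRF, integral_const, probReal_univ, one_smul,
      integral_finsetSum _ fun i _ => (hR i).1]
    have h1 := Finset.sum_le_sum fun i (_ : i ∈ F) => (hR i).2
    rw [Finset.sum_add_distrib, Finset.sum_const, ← Finset.sum_div, nsmul_eq_mul] at h1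
    have h2 : (F.card : ℝ) * (ε / (3 * (F.card + 1))) ≤ ε / 3 := by
      rw [mul_div_assoc', div_le_div_iff₀ (by positivity) (by norm_num)]
      nlinarith
    have h3 : (∑ i ∈ F, (M i ^ 3 + σ ^ 2 * M i ^ 2)) / n ≤ ε / 3 := hCn
    linarith
  · have := h.expectedVariance_le hk σ (fun i : Fin n => ξ i ω) F (c ω)
    simp only [R]
    linarith

/-- The lower bound makes the excesses `D m` nonnegative, and their means tend to `0`, so their
infimum over `m` is almost surely `0`. Monotonicity in the sample size carries smallness at one size
to all larger ones. -/
theorem IsEigensystem.ae_tendsto_expectedVariance (hk : IsFeatureMap p k)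
    (h : IsEigensystem p (fun x y => ⟪k x, k y⟫_ℝ) lam φ) (hlaw : ∀ i, HasLaw (ξ i) p P)
    (hindep : iIndepFun ξ P) (σ : ℝ) :
    ∀ᵐ ω ∂P, Tendsto (fun n : ℕ => expectedVariance p (fun x y => ⟪k x, k y⟫_ℝ) σ
      (fun i : Fin n => ξ i ω)) atTop (𝓝 ((∫ x, ‖k x‖ ^ 2 ∂p) - ∑' i, lam i)) := by
  have hlower : ∀ {n : ℕ} (X : Fin n → S), (∫ x, ‖k x‖ ^ 2 ∂p) - ∑' i, lam i ≤
      expectedVariance p (fun x y => ⟪k x, k y⟫_ℝ) σ X :=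
    hk.sub_le_expectedVariance (h.summable_and_hilbertSchmidtBound hk).2.2 σ
  choose n D hDi hDε hD using fun m : ℕ =>
    h.exists_expectedVariance_le_add hk hlaw hindep σ (Nat.one_div_pos_of_nat (n := m) (α := ℝ))
  have hD0 : ∀ m ω, 0 ≤ D m ω := fun m ω => by
    linarith [hD m ω, hlower (fun i : Fin (n m) => ξ i ω)]
  have hinf : ∀ᵐ ω ∂P, ⨅ m, ENNReal.ofReal (D m ω) = 0 := by
    refine (lintegral_eq_zero_iff' (AEMeasurable.iInf fun m =>
      (hDi m).aestronglyMeasurable.aemeasurable.ennreal_ofReal)).mp ?_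
    refine le_antisymm (ge_of_tendsto' (f := fun m : ℕ => ENNReal.ofReal (1 / ((m : ℝ) + 1)))
      (x := atTop) ?_ fun m => ?_) zero_le
    · have := ENNReal.tendsto_ofReal (tendsto_one_div_add_atTop_nhds_zero_nat (𝕜 := ℝ))
      simpa using this
    · calc ∫⁻ ω, ⨅ m, ENNReal.ofReal (D m ω) ∂P ≤ ∫⁻ ω, ENNReal.ofReal (D m ω) ∂P :=
            lintegral_mono fun ω => iInf_le _ m
        _ = ENNReal.ofReal (∫ ω, D m ω ∂P) :=
            (ofReal_integral_eq_lintegral_ofReal (hDi m) (ae_of_all _ (hD0 m))).symm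
        _ ≤ ENNReal.ofReal (1 / ((m : ℝ) + 1)) := ENNReal.ofReal_le_ofReal (hDε m)
  filter_upwards [hinf] with ω hω
  have hanti := hk.expectedVariance_antitone σ (fun i => ξ i ω)
  refine tendsto_order.mpr ⟨fun b hb => Eventually.of_forall fun j => hb.trans_le (hlower _),
    fun b hb => ?_⟩
  have hpos : 0 < ENNReal.ofReal (b - ((∫ x, ‖k x‖ ^ 2 ∂p) - ∑' i, lam i)) :=
    ENNReal.ofReal_pos.mpr (sub_pos.mpr hb)
  rw [← hω] at hpos
  obtain ⟨m, hm⟩ := iInf_lt_iff.mp hpos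
  rw [ENNReal.ofReal_lt_ofReal_iff (sub_pos.mpr hb)] at hm
  filter_upwards [eventually_ge_atTop (n m)] with j hj
  have := hanti hj
  simp only at this
  linarith [hD m ω]

end Random

/-- Sharpness is probabilistic: one good outcome of an i.i.d. sequence supplies training sets
approaching the bound. -/
theorem IsEigensystem.isGLB_expectedVariance (hk : IsFeatureMap p k)
    (h : IsEigensystem p (fun x y => ⟪k x, k y⟫_ℝ) lam φ) (σ : ℝ) :
    IsGLB {v : ℝ | ∃ (m : ℕ) (X : Fin m → S),
        v = expectedVariance p (fun x y => ⟪k x, k y⟫_ℝ) σ X}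
      ((∫ x, ‖k x‖ ^ 2 ∂p) - ∑' i, lam i) := by
  refine ⟨?_, fun b hb => ?_⟩
  · rintro _ ⟨m, X, rfl⟩
    exact hk.sub_le_expectedVariance (h.summable_and_hilbertSchmidtBound hk).2.2 σ X
  · obtain ⟨Ω, _, P, ξ, -, hlaw, hindep, _⟩ := exists_iid ℕ p
    obtain ⟨ω, hω⟩ := (h.ae_tendsto_expectedVariance hk hlaw hindep σ).exists
    exact ge_of_tendsto' hω fun n => hb ⟨n, _, rfl⟩

end Convergence

/-! ### The RBF kernel as a mixture of cosines. -/

section RBF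

/-- The real part of the characteristic function of a standard Gaussian at the difference of the
rescaled points. -/
theorem rbfKernel_eq_integral_cos {d : ℕ} (ℓ : Fin d → ℝ) (x y : EuclideanSpace ℝ (Fin d)) :
    rbfKernel ℓ x y = ∫ z, Real.cos (⟪z, WithLp.toLp 2 fun i => x i / ℓ i⟫_ℝ -
      ⟪z, WithLp.toLp 2 fun i => y i / ℓ i⟫_ℝ) ∂stdGaussian (EuclideanSpace ℝ (Fin d)) := by
  set a : EuclideanSpace ℝ (Fin d) := WithLp.toLp 2 fun i => x i / ℓ i with ha
  set b : EuclideanSpace ℝ (Fin d) := WithLp.toLp 2 fun i => y i / ℓ i with hb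
  have h1 := charFun_stdGaussian (a - b)
  rw [charFun_apply] at h1
  have hint : Integrable (fun z => Complex.exp (⟪z, a - b⟫_ℝ * Complex.I))
      (stdGaussian (EuclideanSpace ℝ (Fin d))) := by
    refine Integrable.of_bound (by fun_prop) 1 (ae_of_all _ fun z => ?_)
    rw [Complex.norm_exp_ofReal_mul_I]
  have h2 := integral_re hint
  rw [h1] at h2
  simp only [RCLike.re_to_complex, Complex.exp_ofReal_mul_I_re, inner_sub_right] at h2
  have h3 : ∑ i, ((x i - y i) / ℓ i) ^ 2 = ‖a - b‖ ^ 2 := by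
    rw [EuclideanSpace.norm_sq_eq]
    exact Finset.sum_congr rfl fun i _ => by simp [ha, hb, sub_div]
  have h4 : -(‖a - b‖ : ℂ) ^ 2 / 2 = ((-(1 / 2) * ‖a - b‖ ^ 2 : ℝ) : ℂ) := by push_cast; ring
  rw [h2, rbfKernel, h3, h4, Complex.exp_ofReal_re]

/-- `cos (s - t) = cos s cos t + sin s sin t` turns the quadratic form into the integral of a sum of
two squares. -/
theorem isCovarianceKernel_rbfKernel {d : ℕ} (ℓ : Fin d → ℝ) :
    IsCovarianceKernel (rbfKernel ℓ) := by
  intro n X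
  refine Matrix.PosSemidef.of_dotProduct_mulVec_nonneg ?_ fun w => ?_
  · ext i j
    simp only [kernelMatrix, rbfKernel, Matrix.conjTranspose_apply, Matrix.of_apply, star_trivial]
    congr 2
    exact Finset.sum_congr rfl fun l _ => by rw [← neg_sub, neg_div, neg_sq]
  · let t : Fin n → EuclideanSpace ℝ (Fin d) → ℝ :=
      fun i z => ⟪z, WithLp.toLp 2 fun l => X i l / ℓ l⟫_ℝ
    have hint : ∀ i j, Integrable (fun z => w i * (Real.cos (t i z - t j z) * w j))
        (stdGaussian (EuclideanSpace ℝ (Fin d))) := fun i j => by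
      refine ((Integrable.of_bound (C := 1) ?_ (ae_of_all _ fun z => ?_)).mul_const _).const_mul _
      · fun_prop
      · exact Real.abs_cos_le_one _
    have h1 : star w ⬝ᵥ (kernelMatrix (rbfKernel ℓ) X).mulVec w =
        ∫ z, ∑ i, ∑ j, w i * (Real.cos (t i z - t j z) * w j)
          ∂stdGaussian (EuclideanSpace ℝ (Fin d)) := by
      rw [integral_finsetSum _ fun i _ => integrable_finsetSum _ fun j _ => hint i j]
      simp only [dotProduct, Matrix.mulVec, kernelMatrix, Matrix.of_apply, star_trivial,
        Finset.mul_sum]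
      refine Finset.sum_congr rfl fun i _ => ?_
      rw [integral_finsetSum _ fun j _ => hint i j]
      refine Finset.sum_congr rfl fun j _ => ?_
      rw [integral_const_mul, integral_mul_const, rbfKernel_eq_integral_cos]
    rw [h1]
    refine integral_nonneg fun z => ?_
    have h2 : ∑ i, ∑ j, w i * (Real.cos (t i z - t j z) * w j) =
        (∑ i, w i * Real.cos (t i z)) ^ 2 + (∑ i, w i * Real.sin (t i z)) ^ 2 := by
      rw [sq, sq, Finset.sum_mul_sum, Finset.sum_mul_sum, ← Finset.sum_add_distrib]
      refine Finset.sum_congr rfl fun i _ => ?_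
      rw [← Finset.sum_add_distrib]
      refine Finset.sum_congr rfl fun j _ => ?_
      rw [Real.cos_sub]
      ring
    simp only [h2]
    positivity

theorem continuous_rbfKernel {d : ℕ} (ℓ : Fin d → ℝ) :
    Continuous (Function.uncurry (rbfKernel ℓ)) := by
  unfold Function.uncurry rbfKernel
  fun_prop

theorem rbfKernel_self {d : ℕ} (ℓ : Fin d → ℝ) (x : EuclideanSpace ℝ (Fin d)) :
    rbfKernel ℓ x x = 1 := by
  simp [rbfKernel]

end RBF

/-! ### Noiseless observations along a dense sequence. -/

section NoiselessLimit

variable {S : Type*} [TopologicalSpace S] [MeasurableSpace S]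
  {H : Type*} [NormedAddCommGroup H] [InnerProductSpace ℝ H] {k : S → H} {p : Measure S}

/-- For a continuous feature map, noiseless observations at a dense sequence determine the
process. -/
theorem IsFeatureMap.tendsto_expectedVariance_denseRange (hk : IsFeatureMap p k)
    (hcont : Continuous k) {s : ℕ → S} (hs : DenseRange s) :
    Tendsto (fun n : ℕ => expectedVariance p (fun x y => ⟪k x, k y⟫_ℝ) 0 (fun i : Fin n => s i))
      atTop (𝓝 0) := by
  have hlim : Tendsto (fun n : ℕ => ∫ x, posteriorVariance (fun x y => ⟪k x, k y⟫_ℝ) 0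
      (fun i : Fin n => s i) x ∂p) atTop (𝓝 (∫ _, (0 : ℝ) ∂p)) := by
    refine tendsto_integral_of_dominated_convergence (fun x => ‖k x‖ ^ 2)
      (fun n => (hk.integrable_posteriorVariance 0 _).aestronglyMeasurable) hk.integrable
      (fun n => ae_of_all _ fun x => ?_) (ae_of_all _ fun x => ?_)
    · rw [Real.norm_of_nonneg (posteriorVariance_nonneg k 0 _ x)]
      exact posteriorVariance_le_norm_sq k 0 _ x
    · refine tendsto_order.mpr ⟨fun b hb => Eventually.of_forall fun n =>
        hb.trans_le (posteriorVariance_nonneg k 0 _ x), fun b hb => ?_⟩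
      have hopen : IsOpen {y | ‖k x - k y‖ ^ 2 < b} :=
        isOpen_lt (by fun_prop) continuous_const
      obtain ⟨j, hj⟩ := hs.exists_mem_open hopen ⟨x, by simpa using hb⟩
      filter_upwards [eventually_gt_atTop j] with n hn
      exact (posteriorVariance_zero_le_norm_sub_sq k (fun i : Fin n => s i) x ⟨j, hn⟩).trans_lt hj
  simpa [expectedVariance] using hlim

end NoiselessLimit

/-! ### Assembling the theorem. -/

theorem IsCovarianceKernel.exists_isFeatureMap {S : Type u} [MeasurableSpace S] {p : Measure S}
    {K : S → S → ℝ} (hK : IsCovarianceKernel K) (hm : Measurable (Function.uncurry K))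
    (hint : Integrable (fun x => K x x) p) :
    ∃ (H : Type u) (_ : NormedAddCommGroup H) (_ : InnerProductSpace ℝ H) (_ : CompleteSpace H)
      (k : S → H), IsFeatureMap p k ∧ K = (fun x y => ⟪k x, k y⟫_ℝ) ∧
        ∀ x, K x x = ‖k x‖ ^ 2 := by
  obtain ⟨H, _, _, _, k, hkK, hdense⟩ := hK.exists_featureMap
  have hnorm : ∀ x, K x x = ‖k x‖ ^ 2 := fun x => by rw [← hkK, real_inner_self_eq_norm_sq]
  have heq : K = fun x y => ⟪k x, k y⟫_ℝ := funext₂ fun x y => (hkK x y).symm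
  exact ⟨H, _, _, inferInstance, k, ⟨hdense, heq ▸ hm, by simpa only [hnorm] using hint⟩, heq, hnorm⟩

/-- The value is the infimum for every `σ`, in particular for `σ = 0`: there a dense sequence bounds
it above by `0`, and nonnegativity of variances bounds it below. -/
theorem IsEigensystem.tsum_eq_of_rbfKernel {d : ℕ} {ℓ : Fin d → ℝ}
    {p : Measure (EuclideanSpace ℝ (Fin d))} [IsProbabilityMeasure p] {ι : Type*} {lam : ι → ℝ}
    {φ : ι → EuclideanSpace ℝ (Fin d) → ℝ} (h : IsEigensystem p (rbfKernel ℓ) lam φ) :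
    Summable lam ∧ (∫ x, rbfKernel ℓ x x ∂p) - ∑' i, lam i = 0 := by
  have hc := continuous_rbfKernel ℓ
  obtain ⟨H, _, _, _, k, hk, heq, hnorm⟩ :=
    (isCovarianceKernel_rbfKernel ℓ).exists_isFeatureMap (p := p) hc.measurable
      (by simp [rbfKernel_self])
  have hcont : Continuous k := by
    refine continuous_iff_continuousAt.mpr fun x => ?_
    rw [ContinuousAt, tendsto_iff_norm_sub_tendsto_zero]
    -- `k` inherits continuity from the kernel, whose diagonal is `1`.
    have h1 : ∀ y, ‖k y - k x‖ = Real.sqrt (2 - 2 * rbfKernel ℓ y x) := fun y => by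
      have h2 : ‖k y - k x‖ ^ 2 = 2 - 2 * rbfKernel ℓ y x := by
        have hxy : rbfKernel ℓ y x = ⟪k y, k x⟫_ℝ := congrFun₂ heq y x
        rw [norm_sub_sq_real, ← hnorm, ← hnorm, rbfKernel_self, rbfKernel_self, hxy]
        ring
      rw [← h2, Real.sqrt_sq (norm_nonneg _)]
    have h2 : Continuous fun y => Real.sqrt (2 - 2 * rbfKernel ℓ y x) :=
      (continuous_const.sub (continuous_const.mul
        (hc.comp (continuous_id.prodMk continuous_const)))).sqrt
    simp only [h1]
    simpa [rbfKernel_self] using h2.tendsto x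
  rw [heq] at h
  simp only [hnorm]
  refine ⟨(h.summable_and_hilbertSchmidtBound hk).2.1, le_antisymm ?_ ?_⟩
  · refine ge_of_tendsto' (hk.tendsto_expectedVariance_denseRange hcont
      (TopologicalSpace.denseRange_denseSeq _)) fun n => ?_
    exact (h.isGLB_expectedVariance hk 0).1 ⟨n, _, rfl⟩
  · refine (h.isGLB_expectedVariance hk 0).2 ?_
    rintro _ ⟨m, X, rfl⟩
    exact integral_nonneg fun x => posteriorVariance_nonneg k 0 X x

end

theorem theorem1 :
    (∀ {S : Type*} [MeasurableSpace S] (p : Measure S) [IsProbabilityMeasure p] (K : S → S → ℝ),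
      IsCovarianceKernel K → Measurable (Function.uncurry K) →
      Integrable (fun x => K x x) p →
      (∃ (ι : Type) (_ : Countable ι) (lam : ι → ℝ) (φ : ι → S → ℝ), IsEigensystem p K lam φ) ∧
      (∀ (σ : ℝ) (m : ℕ) (X' : Fin m → S), Integrable (posteriorVariance K σ X') p) ∧
      (∀ (σ : ℝ) {Ω : Type*} [MeasurableSpace Ω] (P : Measure Ω) [IsProbabilityMeasure P]
        (ξ : ℕ → Ω → S), (∀ i, HasLaw (ξ i) p P) → iIndepFun ξ P →
        ∀ᵐ ω ∂P, ∀ ε : ℝ, 0 < ε → ∃ N : ℕ, ∀ n ≥ N, ∀ (m : ℕ) (X' : Fin m → S),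
          expectedVariance p K σ (fun i : Fin n => ξ i ω) ≤ expectedVariance p K σ X' + ε) ∧
      (∀ {ι : Type*} (lam : ι → ℝ) (φ : ι → S → ℝ), IsEigensystem p K lam φ →
        Summable lam ∧
        ∀ σ : ℝ,
          IsGLB {v : ℝ | ∃ (m : ℕ) (X' : Fin m → S), v = expectedVariance p K σ X'}
            ((∫ x, K x x ∂p) - ∑' i, lam i) ∧
          ∀ {Ω : Type*} [MeasurableSpace Ω] (P : Measure Ω) [IsProbabilityMeasure P]
            (ξ : ℕ → Ω → S), (∀ i, HasLaw (ξ i) p P) → iIndepFun ξ P →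
            ∀ᵐ ω ∂P, Tendsto (fun n : ℕ => expectedVariance p K σ (fun i : Fin n => ξ i ω)) atTop
              (𝓝 ((∫ x, K x x ∂p) - ∑' i, lam i)))) ∧
    (∀ {d : ℕ} (ℓ : Fin d → ℝ), (∀ i, 0 < ℓ i) →
      IsCovarianceKernel (rbfKernel ℓ) ∧
      ∀ (p : Measure (EuclideanSpace ℝ (Fin d))) [IsProbabilityMeasure p] {ι : Type*}
        (lam : ι → ℝ) (φ : ι → EuclideanSpace ℝ (Fin d) → ℝ),
        IsEigensystem p (rbfKernel ℓ) lam φ →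
        Summable lam ∧ (∫ x, rbfKernel ℓ x x ∂p) - ∑' i, lam i = 0) := by
  refine ⟨?_, ?_⟩
  · intro S _ p _ K hK hm hint
    obtain ⟨H, _, _, _, k, hk, rfl, hnorm⟩ := hK.exists_isFeatureMap hm hint
    simp only [hnorm]
    refine ⟨hk.exists_isEigensystem, fun σ m X => hk.integrable_posteriorVariance σ X, ?_, ?_⟩
    · intro σ Ω _ P _ ξ hlaw hindep
      -- Any eigensystem will do: it identifies the almost sure limit with a lower bound for all
      -- training sets.
      obtain ⟨κ, _, lam, φ, h⟩ := hk.exists_isEigensystem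
      filter_upwards [h.ae_tendsto_expectedVariance hk hlaw hindep σ] with ω hω ε hε
      obtain ⟨N, hN⟩ := eventually_atTop.mp (hω.eventually (gt_mem_nhds (lt_add_of_pos_right _ hε)))
      refine ⟨N, fun n hn m X => (hN n hn).le.trans ?_⟩
      exact add_le_add_left ((h.isGLB_expectedVariance hk σ).1 ⟨m, X, rfl⟩) ε
    · intro ι lam φ h
      refine ⟨(h.summable_and_hilbertSchmidtBound hk).2.1, fun σ =>
        ⟨h.isGLB_expectedVariance hk σ, ?_⟩⟩
      intro Ω _ P _ ξ hlaw hindep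
      exact h.ae_tendsto_expectedVariance hk hlaw hindep σ
  · intro d ℓ _
    refine ⟨isCovarianceKernel_rbfKernel ℓ, ?_⟩
    intro p _ ι lam φ h
    exact h.tsum_eq_of_rbfKernel
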